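/- **Notation.** For $\alpha>0$ let $n=\lceil\alpha\rceil$, so that $n-1<\alpha\le n$. For $\beta>0$ put $I^{\beta}f(t)=\frac1{\Gamma(\beta)}\int_0^t(t-v)^{\beta-1}f(v)\,dv$, and $I^0f=f$. The Caputo derivative is ${}^{C}D^{\alpha}f=I^{n-\alpha}f^{(n)}$. The Riemann–Liouville derivative is ${}^{RL}D^{\alpha}f=\frac{d^n}{dt^n}I^{n-\alpha}f$, with ${}^{RL}D^{-\beta}f=I^{\beta}f$ for $\beta\ge0$. For $a,b,r>0$ let $$E^{r}_{a,b}(z)=\sum_{p\ge0}\frac{\Gamma(r+p)\,z^p}{p!\,\Gamma(r)\,\Gamma(ap+b)},\qquad (f*g)(t)=\int_0^tf(t-s)g(s)\,ds ,$$ $\rho_1(t)=1$ for $t<0$ and $\rho_1(t)=0$ for $t\ge 0$. For $\alpha,\tau,b>0$, $c,h\in\mathbb R$ and $t\ge0$ let $$S^{\alpha,\tau}_{c,h;b}(t)=\sum_{m=0}^{\lfloor t/\tau\rfloor}h^m(t-\tau m)^{\alpha m+b-1}E^{m+1}_{\alpha,\alpha m+b}\big(c(t-\tau m)^{\alpha}\big).$$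 **System.** Let $\alpha_1,\alpha_2\in(0,2]$, $\tau_1,\tau_2>0$, $\mu=\mu_{2,0}>0$, let all other coefficients be real, and consider $$\begin{aligned}\partial_t^{\alpha_1}u_1=&\ \partial_x\big[(a_{12}u_2+a_{11}u_1+a_{10})\partial_xu_1+(b_{12}u_2-a_{12}u_1+\tfrac{\gamma_{12}}{\mu})\partial_xu_2\big]\\&-\mu a_{12}u_1u_2+2\mu b_{12}u_2^2+\gamma_{12}u_2+\gamma_{11}u_1+\gamma_{10}+\hat\gamma_{11}\hat u_1,\\ \partial_t^{\alpha_2}u_2=&\ \partial_x\big[(a_{22}u_2+a_{20})\partial_xu_1+(b_{21}u_1+b_{20})\partial_xu_2\big]+\mu b_{21}u_1u_2+\gamma_{22}u_2+\hat\gamma_{22}\hat u_2,\end{aligned}$$ for $t>0$, $x\in\mathbb R$, with $\hat u_k(x,t)=u_k(x,t-\tau_k)$ and $u_k(x,t)=\phi_k(x,t)$ for $t\in[-\tau_k,0]$. Write $R[U,\hat U]=(R_1,R_2)$ for the right-hand side, where $U=(u_1,u_2)$ and $\hat U=(\hat u_1,\hat u_2)$. **Invariance.** The space $Y=\mathcal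 L\{1,x\}\times\mathcal L\{\sin(\sqrt\mu x),\cos(\sqrt\mu x)\}$ is invariant: $R[U,\hat U]\in Y$ for all $U,\hat U\in Y$. From now on let $a_{11}=b_{12}=0$ and $a_{22}=-b_{21}$, and put $C=\gamma_{22}-\mu b_{20}$. **Reduction.** If $U=(p_1+q_1x,\ p_2\sin(\sqrt\mu x)+q_2\cos(\sqrt\mu x))$ and $\hat U=(r_1+s_1x,\ r_2\sin(\sqrt\mu x)+s_2\cos(\sqrt\mu x))$, then $$R_1=(\gamma_{10}+\gamma_{11}p_1+\hat\gamma_{11}r_1)+(\gamma_{11}q_1+\hat\gamma_{11}s_1)x,$$ $$R_2=(Cp_2+\hat\gamma_{22}r_2)\sin(\sqrt\mu x)+(Cq_2+\hat\gamma_{22}s_2)\cos(\sqrt\mu x).$$ So for $u_1=\delta_{11}(t)+\delta_{12}(t)x$ and $u_2=\delta_{21}(t)\sin(\sqrt\mu x)+\delta_{22}(t)\cos(\sqrt\mu x)$ the system reduces to $$D^{\alpha_1}\delta_{1i}(t)=g_{1i}+\gamma_{11}\delta_{1i}(t)+\hat\gamma_{11}\delta_{1i}(t-\tau_1),\qquad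 D^{\alpha_2}\delta_{2i}(t)=C\delta_{2i}(t)+\hat\gamma_{22}\delta_{2i}(t-\tau_2)\qquad(i=1,2),\tag{$*$}$$ with $g_{11}=\gamma_{10}$ and $g_{12}=0$. Let $\phi_1=\varphi_{11}(t)+\varphi_{12}(t)x$ and $\phi_2=\varphi_{21}(t)\sin(\sqrt\mu x)+\varphi_{22}(t)\cos(\sqrt\mu x)$. Put $(c_1,h_1)=(\gamma_{11},\hat\gamma_{11})$, $(c_2,h_2)=(C,\hat\gamma_{22})$, $g_{21}=g_{22}=0$ and $S_{k;b}=S^{\alpha_k,\tau_k}_{c_k,h_k;b}$. **Caputo case.** Let each $\varphi_{ki}$ be absolutely continuous on $[-\tau_k,0]$, let $\beta_{ki}=\varphi_{ki}(0)$, and let $\kappa_{ki}\in\mathbb R$. Let $\delta_{ki}=\varphi_{ki}$ on $[-\tau_k,0]$ and, for $t>0$, $$\delta_{ki}(t)=h_k\,S_{k;\alpha_k}*\big(\varphi_{ki}(\cdot-\tau_k)\rho_1(\cdot-\tau_k)\big)(t)+g_{ki}S_{k;\alpha_k+1}(t)+\beta_{ki}S_{k;1}(t)+\begin{cases}\kappa_{ki}S_{k;2}(t),&\alpha_k>1,\\0,&\alpha_k\le1.\end{cases}$$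 Then, with Caputo derivatives, the $\delta_{ki}$ satisfy $(*)$, and $u_1=\delta_{11}+\delta_{12}x$, $u_2=\delta_{21}\sin(\sqrt\mu x)+\delta_{22}\cos(\sqrt\mu x)$ satisfy the system for all $t>0$ and $x\in\mathbb R$, with the histories $\phi_k$. Here, with $n_k=\lceil\alpha_k\rceil$, $u_k(x,\cdot)$ is $C^{n_k-1}$ on $[0,T]$ with absolutely continuous derivative of order $n_k-1$, for every $T>0$, and likewise for $\delta_{ki}$. Moreover $u_1(x,0)=\beta_{11}+\beta_{12}x$ and $u_2(x,0)=\beta_{21}\sin(\sqrt\mu x)+\beta_{22}\cos(\sqrt\mu x)$. The right derivatives at $t=0$ are $\partial_tu_1(x,0)=\kappa_{11}+\kappa_{12}x$ if $\alpha_1>1$, and $\partial_tu_2(x,0)=\kappa_{21}\sin(\sqrt\mu x)+\kappa_{22}\cos(\sqrt\mu x)$ if $\alpha_2>1$. **Riemann–Liouville case.** Let each $\varphi_{ki}$ be continuous on $[-\tau_k,0]$, and let $\hat\beta_{ki},\hat\kappa_{ki}\in\mathbb R$. Let $\delta_{ki}=\varphi_{ki}$ on $[-\tau_k,0]$ and,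 for $t>0$, $$\delta_{ki}(t)=h_k\,S_{k;\alpha_k}*\big(\varphi_{ki}(\cdot-\tau_k)\rho_1(\cdot-\tau_k)\big)(t)+g_{ki}S_{k;\alpha_k+1}(t)+\hat\beta_{ki}S_{k;\alpha_k}(t)+\begin{cases}\hat\kappa_{ki}S_{k;\alpha_k-1}(t),&\alpha_k>1,\\0,&\alpha_k\le1,\end{cases}$$ with the convention $0^0=1$ and $0^a=0$ for $a\neq0$ at the isolated times where $t=\tau_km$. Then, with Riemann–Liouville derivatives, the $\delta_{ki}$ satisfy $(*)$, and $u_1,u_2$, formed as before, satisfy the system for all $x\in\mathbb R$, with the histories $\phi_k$; the $k$-th equations hold at every $t>0$ that is not an integer multiple of $\tau_k$. Here, with $n_k=\lceil\alpha_k\rceil$, $u_k(x,\cdot)$ is locally integrable on $[0,\infty)$, and $I^{n_k-\alpha_k}u_k(x,\cdot)$ exists and is $C^{n_k-1}$ on all of $(0,\infty)$. Moreover, as $t\to0^+$, $${}^{RL}\partial_t^{\alpha_1-1}u_1\to\hat\beta_{11}+\hat\beta_{12}x,\qquad {}^{RL}\partial_t^{\alpha_2-1}u_2\to\hat\beta_{21}\sin(\sqrt\mu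 x)+\hat\beta_{22}\cos(\sqrt\mu x).$$ If $\alpha_1>1$, then ${}^{RL}\partial_t^{\alpha_1-2}u_1\to\hat\kappa_{11}+\hat\kappa_{12}x$, and if $\alpha_2>1$, then ${}^{RL}\partial_t^{\alpha_2-2}u_2\to\hat\kappa_{21}\sin(\sqrt\mu x)+\hat\kappa_{22}\cos(\sqrt\mu x)$; for $\alpha_k\le1$ the limit of ${}^{RL}\partial_t^{\alpha_k-2}u_k$ is $0$. **Boundary values.** In both cases, for every $\lambda\in\mathbb R$, $u_1(0,t)=\delta_{11}(t)$, $u_1(\lambda,t)=\delta_{11}(t)+\lambda\delta_{12}(t)$, $u_2(0,t)=\delta_{22}(t)$ and $u_2(\lambda,t)=\sin(\lambda\sqrt\mu)\delta_{21}(t)+\cos(\lambda\sqrt\mu)\delta_{22}(t)$. -/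

import Mathlib

open Set Filter Topology MeasureTheory

noncomputable section

/-- The Riemann-Liouville fractional integral `I^β f (t)` of order `β ≥ 0` based at `0`, with
`I^0 f = f`. -/
def fracInt (β : ℝ) (f : ℝ → ℝ) (t : ℝ) : ℝ :=
  if β = 0 then f t else 1 / Real.Gamma β * ∫ v in (0 : ℝ)..t, (t - v) ^ (β - 1) * f v

/-- The integral defining `I^β f (t)` exists as a Lebesgue integral. -/
def FracIntegrable (β : ℝ) (f : ℝ → ℝ) (t : ℝ) : Prop :=
  β = 0 ∨ IntervalIntegrable (fun v => (t - v) ^ (β - 1) * f v) volume 0 t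

/-- The Caputo derivative `I^(n-α) (f^(n)) (t)`, where `n - 1 < α ≤ n`. -/
def caputoDeriv (α : ℝ) (f : ℝ → ℝ) (t : ℝ) : ℝ :=
  fracInt ((⌈α⌉₊ : ℝ) - α) (iteratedDeriv ⌈α⌉₊ f) t

/-- The Riemann-Liouville derivative `(d/dt)^n (I^(n-α) f) (t)`, where `n - 1 < α ≤ n`.
For `α ≤ 0` one has `n = 0`, and this is the fractional integral of order `-α`. -/
def rlDeriv (α : ℝ) (f : ℝ → ℝ) (t : ℝ) : ℝ :=
  iteratedDeriv ⌈α⌉₊ (fracInt ((⌈α⌉₊ : ℝ) - α) f) t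

/-- `f` is `n - 1` times continuously differentiable on `[0, t]` with absolutely continuous
derivative of order `n - 1`, its Caputo derivative of order `α > 0` exists at `t > 0`
(as a convergent integral, or as a classical derivative if `α = n`) and equals `y`. -/
def HasCaputoDeriv (α : ℝ) (f : ℝ → ℝ) (t y : ℝ) : Prop :=
  ContDiffOn ℝ ((⌈α⌉₊ - 1 : ℕ) : WithTop ℕ∞) f (Icc 0 t) ∧
  AbsolutelyContinuousOnInterval (iteratedDerivWithin (⌈α⌉₊ - 1) f (Icc 0 t)) 0 t ∧
  FracIntegrable ((⌈α⌉₊ : ℝ) - α) (iteratedDeriv ⌈α⌉₊ f) t ∧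
  (α = (⌈α⌉₊ : ℝ) → DifferentiableAt ℝ (iteratedDeriv (⌈α⌉₊ - 1) f) t) ∧
  caputoDeriv α f t = y

/-- `f` is locally integrable on `[0, ∞)`, the fractional integral `I^(n-α) f` exists on `(0, ∞)`
and is `n - 1` times continuously differentiable there. -/
def RLRegular (α : ℝ) (f : ℝ → ℝ) : Prop :=
  (∀ T : ℝ, 0 < T → IntervalIntegrable f volume 0 T) ∧
  (∀ s : ℝ, 0 < s → FracIntegrable ((⌈α⌉₊ : ℝ) - α) f s) ∧
  ContDiffOn ℝ ((⌈α⌉₊ - 1 : ℕ) : WithTop ℕ∞) (fracInt ((⌈α⌉₊ : ℝ) - α) f) (Ioi 0)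

/-- `I^(n-α) f` is `n` times continuously differentiable near `t`, and its `n`-th derivative at
`t`, the Riemann-Liouville derivative of `f`, equals `y`. -/
def HasRLDeriv (α : ℝ) (f : ℝ → ℝ) (t y : ℝ) : Prop :=
  ContDiffAt ℝ (⌈α⌉₊ : WithTop ℕ∞) (fracInt ((⌈α⌉₊ : ℝ) - α) f) t ∧ rlDeriv α f t = y

/-- The three-parameter Mittag-Leffler function
`E^r_{a,b}(z) = ∑_p Γ(r+p) z^p / (p! Γ(r) Γ(a p + b))`. -/
def mittagLeffler3 (a b r z : ℝ) : ℝ :=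
  ∑' p : ℕ, Real.Gamma (r + p) * z ^ p /
    ((p.factorial : ℝ) * Real.Gamma r * Real.Gamma (a * p + b))

/-- The finite sum over `0 ≤ m ≤ ⌊t/τ⌋` of
`h^m (t - τ m)^(α m + b - 1) E^(m+1)_{α, α m + b}(c (t - τ m)^α)`. -/
def delayML (α τ c h b t : ℝ) : ℝ :=
  ∑ m ∈ Finset.range (⌊t / τ⌋₊ + 1),
    h ^ m * (t - τ * m) ^ (α * m + b - 1) *
      mittagLeffler3 α (α * m + b) (m + 1) (c * (t - τ * m) ^ α)

/-- The convolution product of functions on the half-line. -/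
def conv (f g : ℝ → ℝ) (t : ℝ) : ℝ := ∫ s in (0 : ℝ)..t, f (t - s) * g s

/-- The indicator function of the negative half-line. -/
def rho (t : ℝ) : ℝ := if t < 0 then 1 else 0

/-- The coefficient function for the Caputo derivative: equal to the history `φ` for `t ≤ 0`;
for `t > 0` given in terms of `φ`, of the initial value `β = φ 0`, of the initial velocity `κ`
(used for `1 < α` only) and of the constant source `g`. -/
def deltaCaputo (α τ c h g : ℝ) (φ : ℝ → ℝ) (κ t : ℝ) : ℝ :=
  if t ≤ 0 then φ t
  else h * conv (delayML α τ c h α) (fun s => φ (s - τ) * rho (s - τ)) t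
    + g * delayML α τ c h (α + 1) t + φ 0 * delayML α τ c h 1 t
    + (if 1 < α then κ * delayML α τ c h 2 t else 0)

/-- The coefficient function for the Riemann-Liouville derivative: equal to the history `φ` for
`t ≤ 0`; for `t > 0` given in terms of `φ`, of the fractional initial data `β`, `κ` (`κ` is used
for `1 < α` only) and of the constant source `g`. -/
def deltaRL (α τ c h g : ℝ) (φ : ℝ → ℝ) (β κ t : ℝ) : ℝ :=
  if t ≤ 0 then φ t
  else h * conv (delayML α τ c h α) (fun s => φ (s - τ) * rho (s - τ)) t
    + g * delayML α τ c h (α + 1) t + β * delayML α τ c h α t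
    + (if 1 < α then κ * delayML α τ c h (α - 1) t else 0)

/-- The real coefficients of the diffusion-reaction system; `γ'₁₁`, `γ'₂₂` are the coefficients
of the delayed terms and `μ` stands for `μ_{2,0}`. -/
structure DRCoeff where
  (a₁₀ a₁₁ a₁₂ a₂₀ a₂₂ b₁₂ b₂₀ b₂₁ γ₁₀ γ₁₁ γ₁₂ γ₂₂ γ'₁₁ γ'₂₂ μ : ℝ)

/-- The right-hand side of the system, as an operator on pairs `U = (u₁, u₂)` and
`V = (û₁, û₂)` of functions of `x`. -/
def drOp (c : DRCoeff) (U V : (ℝ → ℝ) × (ℝ → ℝ)) : (ℝ → ℝ) × (ℝ → ℝ) :=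
  (fun x =>
      deriv (fun y => (c.a₁₂ * U.2 y + c.a₁₁ * U.1 y + c.a₁₀) * deriv U.1 y
        + (c.b₁₂ * U.2 y - c.a₁₂ * U.1 y + c.γ₁₂ / c.μ) * deriv U.2 y) x
      - c.μ * c.a₁₂ * U.1 x * U.2 x + 2 * c.μ * c.b₁₂ * U.2 x ^ 2
      + c.γ₁₂ * U.2 x + c.γ₁₁ * U.1 x + c.γ₁₀ + c.γ'₁₁ * V.1 x,
   fun x =>
      deriv (fun y => (c.a₂₂ * U.2 y + c.a₂₀) * deriv U.1 y
        + (c.b₂₁ * U.1 y + c.b₂₀) * deriv U.2 y) x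
      + c.μ * c.b₂₁ * U.1 x * U.2 x + c.γ₂₂ * U.2 x + c.γ'₂₂ * V.2 x)

/-- The space `span {1, x} × span {sin (√μ x), cos (√μ x)}`. -/
def polyTrigSpace (μ : ℝ) : Submodule ℝ ((ℝ → ℝ) × (ℝ → ℝ)) :=
  (Submodule.span ℝ {(fun _ => 1 : ℝ → ℝ), (fun x => x : ℝ → ℝ)}).prod
    (Submodule.span ℝ {(fun x => Real.sin (√μ * x) : ℝ → ℝ),
      (fun x => Real.cos (√μ * x) : ℝ → ℝ)})

/-- `p + q x`. -/
def linPart (p q x : ℝ) : ℝ := p + q * x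

/-- `p sin (√μ x) + q cos (√μ x)`. -/
def trigPart (μ p q x : ℝ) : ℝ := p * Real.sin (√μ * x) + q * Real.cos (√μ * x)

/-- `(u₁, u₂)` solves the system for `t > 0` in the sense of Caputo, with histories `φ₁`, `φ₂`. -/
structure IsCaputoSolution (c : DRCoeff) (α₁ α₂ τ₁ τ₂ : ℝ) (φ₁ φ₂ u₁ u₂ : ℝ → ℝ → ℝ) :
    Prop where
  history₁ : ∀ x, ∀ t ∈ Icc (-τ₁) 0, u₁ x t = φ₁ x t
  history₂ : ∀ x, ∀ t ∈ Icc (-τ₂) 0, u₂ x t = φ₂ x t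
  eq₁ : ∀ x t, 0 < t → HasCaputoDeriv α₁ (fun s => u₁ x s) t
    ((drOp c (fun y => u₁ y t, fun y => u₂ y t)
      (fun y => u₁ y (t - τ₁), fun y => u₂ y (t - τ₂))).1 x)
  eq₂ : ∀ x t, 0 < t → HasCaputoDeriv α₂ (fun s => u₂ x s) t
    ((drOp c (fun y => u₁ y t, fun y => u₂ y t)
      (fun y => u₁ y (t - τ₁), fun y => u₂ y (t - τ₂))).2 x)

/-- `(u₁, u₂)` solves the system for `t > 0` in the sense of Riemann-Liouville, with histories
`φ₁`, `φ₂`; the `k`-th equation holds at all times that are not multiples of `τ_k`. At these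
multiples `u_k (x, t - τ_k)` is in general discontinuous in `t` (the solution may have a jump or a
singularity at `t = 0`). -/
structure IsRLSolution (c : DRCoeff) (α₁ α₂ τ₁ τ₂ : ℝ) (φ₁ φ₂ u₁ u₂ : ℝ → ℝ → ℝ) :
    Prop where
  history₁ : ∀ x, ∀ t ∈ Icc (-τ₁) 0, u₁ x t = φ₁ x t
  history₂ : ∀ x, ∀ t ∈ Icc (-τ₂) 0, u₂ x t = φ₂ x t
  regular₁ : ∀ x, RLRegular α₁ (fun s => u₁ x s)
  regular₂ : ∀ x, RLRegular α₂ (fun s => u₂ x s)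
  eq₁ : ∀ x t, 0 < t → (∀ m : ℕ, t ≠ m * τ₁) → HasRLDeriv α₁ (fun s => u₁ x s) t
    ((drOp c (fun y => u₁ y t, fun y => u₂ y t)
      (fun y => u₁ y (t - τ₁), fun y => u₂ y (t - τ₂))).1 x)
  eq₂ : ∀ x t, 0 < t → (∀ m : ℕ, t ≠ m * τ₂) → HasRLDeriv α₂ (fun s => u₂ x s) t
    ((drOp c (fun y => u₁ y t, fun y => u₂ y t)
      (fun y => u₁ y (t - τ₁), fun y => u₂ y (t - τ₂))).2 x)

end

/-!
The diffusion-reaction operator maps `linPart p₁ q₁`, `trigPart μ p₂ q₂` to functions of the same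
shape (`drOp_linPart_trigPart`): the products of `u₁` with `u₂` cancel because `u₂'' = -μ u₂`, and
the quadratic terms in `u₂` combine to `μ (p₂² + q₂²)` because `sin² + cos² = 1`. This gives the
invariance and the reduction. As `deltaCaputo` and `deltaRL` are linear in their data, `u_k (x, ·)`
is itself such a function, so everything else is a statement about one scalar delay equation.

For that equation all functions are extended by `0` to `(-∞, 0]`, and fractional integration becomes
convolution with the kernel `k_b(t) = t ^ (b - 1) / Γ(b)` (`rlKernel`). With
`L f = c f + h f (· - τ)` (`delayOp`), the delayed Mittag-Leffler sum of order `b` is the Neumann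
series `K_b = ∑ N, L ^ N k_{α N + b}` (`delayKernel`): expanding `L ^ N` by the binomial theorem
gives the coefficients of the three-parameter Mittag-Leffler functions (`delayML_eq_delayKernel`). In
this form `K_b = k_b + L K_{b + α}` (`delayKernel_eq`) and `K_b ⊛ k_β = K_{b + β}`
(`lconv_delayKernel`) are immediate, and the first of them reduces most properties of `K_b` to large
`b`, where `K_b` is continuous (`order_induction`). Hence `y = G ⊛ K_α + β K_a + κ K_b` solves the
Volterra equation `y = β k_a + κ k_b + (G + L y) ⊛ k_α` (`delaySol_eq`, `delaySol_ae_eq`).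

In the Riemann-Liouville case `G` is `h` times the delayed history plus `g`, and the Volterra
equation shows that `I^(n - α) y` is a polynomial with the prescribed coefficients plus the `n`-fold
integral of `w = G + L y`. The function `w` is locally integrable, and it is continuous away from
the multiples of `τ`.

In the Caputo case the same equation is applied to the derivative of the solution. Since the
history is absolutely continuous, `δ = φ(0) + ∫ v₁` (`deltaCaputo_eq`), where `v₁` solves the
equation with source `h` times the derivative of the delayed history and with data
`w₀ = g + c φ(0) + h φ(-τ)` and `κ`. The jumps of the extended history at `0` and `τ` are integrated
explicitly; the one at `τ` cancels against the jump of the delayed initial value. Thus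
`v₁ = κ + w₀ k_α + v ⊛ k_α` almost everywhere, where `w₀ + ∫ v` is the right-hand side of the
delay equation (`deltaCaputo_rhs_eq`), and applying `I^(n - α)` to the derivative of order `n` of `δ`
gives back `w₀ + ∫ v` at every time (`hasCaputoDeriv_of_antideriv`).
-/

/-! ### Convolution of causal functions -/

/-- The convolution product of two real functions on the whole line. For functions vanishing on
`(-∞, 0]` this is the convolution product of the half-line. -/
noncomputable def lconv (f g : ℝ → ℝ) : ℝ → ℝ :=
  convolution f g (ContinuousLinearMap.mul ℝ ℝ) volume

local infixl:67 " ⊛ " => lconv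

/-- The integral defining `(f ⊛ g) x` converges. -/
def LConvAt (f g : ℝ → ℝ) (x : ℝ) : Prop :=
  ConvolutionExistsAt f g x (ContinuousLinearMap.mul ℝ ℝ) volume

/-- A locally integrable function which vanishes on `(-∞, 0]`. -/
structure CausalLI (f : ℝ → ℝ) : Prop where
  causal : ∀ t ≤ 0, f t = 0
  li : LocallyIntegrable f volume

theorem lconv_apply (f g : ℝ → ℝ) (x : ℝ) : (f ⊛ g) x = ∫ t, f t * g (x - t) := rfl

theorem lConvAt_iff {f g : ℝ → ℝ} {x : ℝ} :
    LConvAt f g x ↔ Integrable (fun t => f t * g (x - t)) := Iff.rfl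

theorem lconv_comm (f g : ℝ → ℝ) : f ⊛ g = g ⊛ f := by
  funext x
  rw [lconv_apply, lconv_apply, ← integral_sub_left_eq_self _ volume x]
  simp [mul_comm]

theorem LConvAt.symm {f g : ℝ → ℝ} {x : ℝ} (h : LConvAt f g x) : LConvAt g f x := by
  rw [lConvAt_iff] at *
  simpa [mul_comm] using h.comp_sub_left x

theorem LConvAt.add_left {f₁ f₂ g : ℝ → ℝ} {x : ℝ} (h₁ : LConvAt f₁ g x) (h₂ : LConvAt f₂ g x) :
    LConvAt (fun t => f₁ t + f₂ t) g x := by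
  rw [lConvAt_iff] at *
  simp only [add_mul]
  exact h₁.add h₂

theorem lconv_add_left {f₁ f₂ g : ℝ → ℝ} {x : ℝ} (h₁ : LConvAt f₁ g x) (h₂ : LConvAt f₂ g x) :
    ((fun t => f₁ t + f₂ t) ⊛ g) x = (f₁ ⊛ g) x + (f₂ ⊛ g) x := by
  rw [lConvAt_iff] at *
  simp only [lconv_apply, add_mul]
  exact integral_add h₁ h₂

theorem LConvAt.const_mul_left {f g : ℝ → ℝ} {x : ℝ} (a : ℝ) (h : LConvAt f g x) :
    LConvAt (fun t => a * f t) g x := by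
  rw [lConvAt_iff] at *
  simpa only [mul_assoc] using h.const_mul a

theorem lconv_const_mul_left (f g : ℝ → ℝ) (x a : ℝ) :
    ((fun t => a * f t) ⊛ g) x = a * (f ⊛ g) x := by
  simp only [lconv_apply, mul_assoc]
  exact integral_const_mul _ _

theorem LConvAt.add_right {f g₁ g₂ : ℝ → ℝ} {x : ℝ} (h₁ : LConvAt f g₁ x) (h₂ : LConvAt f g₂ x) :
    LConvAt f (fun t => g₁ t + g₂ t) x := (h₁.symm.add_left h₂.symm).symm

theorem lconv_add_right {f g₁ g₂ : ℝ → ℝ} {x : ℝ} (h₁ : LConvAt f g₁ x) (h₂ : LConvAt f g₂ x) :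
    (f ⊛ (fun t => g₁ t + g₂ t)) x = (f ⊛ g₁) x + (f ⊛ g₂) x := by
  rw [lconv_comm, lconv_add_left h₁.symm h₂.symm, lconv_comm g₁, lconv_comm g₂]

theorem LConvAt.const_mul_right {f g : ℝ → ℝ} {x : ℝ} (a : ℝ) (h : LConvAt f g x) :
    LConvAt f (fun t => a * g t) x := (h.symm.const_mul_left a).symm

theorem lconv_const_mul_right (f g : ℝ → ℝ) (x a : ℝ) :
    (f ⊛ (fun t => a * g t)) x = a * (f ⊛ g) x := by
  rw [lconv_comm, lconv_const_mul_left, lconv_comm]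

theorem lconv_shift_right (f g : ℝ → ℝ) (τ x : ℝ) :
    (f ⊛ (fun t => g (t - τ))) x = (f ⊛ g) (x - τ) := by
  simp only [lconv_apply]
  congr 1 with t
  ring_nf

theorem lconv_shift_left (f g : ℝ → ℝ) (τ x : ℝ) :
    ((fun t => f (t - τ)) ⊛ g) x = (f ⊛ g) (x - τ) := by
  rw [lconv_comm, lconv_shift_right, lconv_comm]

theorem LConvAt.shift_right {f g : ℝ → ℝ} {τ x : ℝ} (h : LConvAt f g (x - τ)) :
    LConvAt f (fun t => g (t - τ)) x := by
  rw [lConvAt_iff] at *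
  convert h using 2 with t
  ring_nf

theorem LConvAt.shift_left {f g : ℝ → ℝ} {τ x : ℝ} (h : LConvAt f g (x - τ)) :
    LConvAt (fun t => f (t - τ)) g x := (LConvAt.shift_right h.symm).symm

theorem lconv_congr_ae_left {f f' : ℝ → ℝ} (g : ℝ → ℝ) (h : f =ᵐ[volume] f') :
    f ⊛ g = f' ⊛ g := by
  funext x
  rw [lconv_apply, lconv_apply]
  apply integral_congr_ae
  filter_upwards [h] with t ht
  rw [ht]

theorem lconv_of_nonpos {f g : ℝ → ℝ} (hf : ∀ t ≤ 0, f t = 0) (hg : ∀ t ≤ 0, g t = 0) {x : ℝ}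
    (hx : x ≤ 0) : (f ⊛ g) x = 0 := by
  rw [lconv_apply]
  rw [integral_eq_zero_of_ae]
  refine Eventually.of_forall fun t => ?_
  rcases le_total t 0 with ht | ht
  · simp [hf t ht]
  · simp [hg (x - t) (by linarith)]

theorem mul_eq_zero_of_notMem_Ioo {f g : ℝ → ℝ} (hf : ∀ t ≤ 0, f t = 0) (hg : ∀ t ≤ 0, g t = 0)
    {x t : ℝ} (ht : t ∉ Ioo 0 x) : f t * g (x - t) = 0 := by
  rcases le_or_gt t 0 with h | h
  · simp [hf t h]
  · have : x ≤ t := by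
      by_contra hx
      exact ht ⟨h, not_le.1 hx⟩
    simp [hg (x - t) (by linarith)]

theorem lconv_eq_intervalIntegral {f g : ℝ → ℝ} (hf : ∀ t ≤ 0, f t = 0) (hg : ∀ t ≤ 0, g t = 0)
    {x : ℝ} (hx : 0 ≤ x) : (f ⊛ g) x = ∫ t in (0 : ℝ)..x, f t * g (x - t) := by
  rw [lconv_apply, intervalIntegral.integral_of_le hx, integral_Ioc_eq_integral_Ioo]
  exact (setIntegral_eq_integral_of_forall_compl_eq_zero
    fun t ht => mul_eq_zero_of_notMem_Ioo hf hg ht).symm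

theorem lConvAt_iff_intervalIntegrable {f g : ℝ → ℝ} (hf : ∀ t ≤ 0, f t = 0)
    (hg : ∀ t ≤ 0, g t = 0) {x : ℝ} (hx : 0 ≤ x) :
    LConvAt f g x ↔ IntervalIntegrable (fun t => f t * g (x - t)) volume 0 x := by
  rw [lConvAt_iff, intervalIntegrable_iff_integrableOn_Ioo_of_le hx,
    integrableOn_iff_integrable_of_support_subset]
  intro t ht
  by_contra h
  exact ht (mul_eq_zero_of_notMem_Ioo hf hg h)

namespace CausalLI

variable {f g k : ℝ → ℝ}

theorem measurable (hf : CausalLI f) : AEStronglyMeasurable f volume := hf.li.aestronglyMeasurable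

theorem add (hf : CausalLI f) (hg : CausalLI g) : CausalLI (fun t => f t + g t) :=
  ⟨fun t ht => by simp [hf.causal t ht, hg.causal t ht], hf.li.add hg.li⟩

theorem const_mul (a : ℝ) (hf : CausalLI f) : CausalLI (fun t => a * f t) :=
  ⟨fun t ht => by simp [hf.causal t ht], by simpa [Pi.smul_def] using hf.li.smul a⟩

theorem abs (hf : CausalLI f) : CausalLI (fun t => |f t|) :=
  ⟨fun t ht => by simp [hf.causal t ht], fun x => by
    obtain ⟨s, hs, h⟩ := hf.li x
    exact ⟨s, hs, h.abs⟩⟩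

theorem intervalIntegrable (hf : CausalLI f) (a b : ℝ) : IntervalIntegrable f volume a b :=
  intervalIntegrable_iff.mpr <|
    (hf.li.integrableOn_isCompact isCompact_uIcc).mono_set uIoc_subset_uIcc

theorem integrable_indicator_Iic (hf : CausalLI f) (T : ℝ) :
    Integrable ((Iic T).indicator f) := by
  have h : IntegrableOn f (Icc 0 T) := hf.li.integrableOn_isCompact isCompact_Icc
  rw [integrable_indicator_iff measurableSet_Iic]
  refine h.of_forall_sdiff_eq_zero measurableSet_Iic fun t ht => hf.causal t ?_
  by_contra h0
  exact ht.2 ⟨(not_le.1 h0).le, ht.1⟩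

theorem of_integrable_indicator (h0 : ∀ t ≤ 0, f t = 0)
    (h : ∀ n : ℕ, Integrable ((Iic (n : ℝ)).indicator f)) : CausalLI f := by
  refine ⟨h0, fun x => ?_⟩
  obtain ⟨n, hn⟩ := exists_nat_gt x
  refine ⟨Iic n, Iic_mem_nhds hn, ?_⟩
  exact (integrable_indicator_iff measurableSet_Iic).1 (h n)

theorem of_intervalIntegrable (h0 : ∀ t ≤ 0, f t = 0)
    (h : ∀ T, 0 < T → IntervalIntegrable f volume 0 T) : CausalLI f := by
  refine ⟨h0, fun x => ?_⟩
  refine ⟨Iic (|x| + 1), Iic_mem_nhds (lt_of_le_of_lt (le_abs_self x) (by linarith)), ?_⟩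
  have := (intervalIntegrable_iff_integrableOn_Ioc_of_le (by positivity)).1
    (h (|x| + 1) (by positivity))
  refine this.of_forall_sdiff_eq_zero measurableSet_Iic fun t ht => h0 t ?_
  by_contra h1
  exact ht.2 ⟨not_le.1 h1, ht.1⟩

theorem of_continuous (h0 : ∀ t ≤ 0, f t = 0) (h : Continuous f) : CausalLI f :=
  ⟨h0, h.locallyIntegrable⟩

theorem shift (hf : CausalLI f) {τ : ℝ} (hτ : 0 ≤ τ) : CausalLI (fun t => f (t - τ)) := by
  refine of_intervalIntegrable (fun t ht => hf.causal _ (by linarith)) fun T _ => ?_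
  simpa using (hf.intervalIntegrable (0 - τ) (T - τ)).comp_sub_right τ

theorem congr_ae (hf : CausalLI f) (h0 : ∀ t ≤ 0, g t = 0) (h : f =ᵐ[volume] g) : CausalLI g :=
  ⟨h0, fun x => (hf.li x).congr h⟩

/-- The convolution product at `x ≤ n` only sees the restrictions of both factors to `(-∞, n]`. -/
theorem mul_indicator_Iic (hf : CausalLI f) (hg : CausalLI g) {n x : ℝ} (hx : x ≤ n) (t : ℝ) :
    (Iic n).indicator f t * (Iic n).indicator g (x - t) = f t * g (x - t) := by
  by_cases ht : t ∈ Ioo 0 x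
  · rw [indicator_of_mem, indicator_of_mem]
    · simp only [mem_Iic]
      linarith [ht.1]
    · simp only [mem_Iic]
      linarith [ht.2]
  · rw [mul_eq_zero_of_notMem_Ioo hf.causal hg.causal ht, mul_eq_zero_of_notMem_Ioo _ _ ht]
    · intro t ht
      simp [indicator_apply, hf.causal t ht]
    · intro t ht
      simp [indicator_apply, hg.causal t ht]

theorem ae_lConvAt (hf : CausalLI f) (hg : CausalLI g) : ∀ᵐ x, LConvAt f g x := by
  have h : ∀ᵐ x, ∀ n : ℕ, LConvAt ((Iic (n : ℝ)).indicator f) ((Iic (n : ℝ)).indicator g) x :=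
    ae_all_iff.2 fun n => (hf.integrable_indicator_Iic n).ae_convolution_exists _
      (hg.integrable_indicator_Iic n)
  filter_upwards [h] with x hx
  obtain ⟨n, hn⟩ := exists_nat_gt x
  have := hx n
  rw [lConvAt_iff] at *
  exact this.congr (Eventually.of_forall fun t => mul_indicator_Iic hf hg hn.le t)

theorem lconv (hf : CausalLI f) (hg : CausalLI g) : CausalLI (f ⊛ g) := by
  refine of_integrable_indicator (fun t ht => lconv_of_nonpos hf.causal hg.causal ht) fun n => ?_
  have h := (hf.integrable_indicator_Iic n).integrable_convolution
    (ContinuousLinearMap.mul ℝ ℝ) (hg.integrable_indicator_Iic n)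
  have h2 := h.indicator (measurableSet_Iic (a := (n : ℝ)))
  refine h2.congr (Eventually.of_forall fun x => ?_)
  by_cases hx : x ≤ n
  · simp only [indicator_of_mem (mem_Iic.2 hx)]
    exact integral_congr_ae (Eventually.of_forall fun t => mul_indicator_Iic hf hg hx t)
  · simp [indicator_of_notMem (mt mem_Iic.1 hx)]

/-- A function bounded on every `(-∞, T]` has a convolution product with every causal locally
integrable function. -/
theorem lConvAt_of_bounded (hf : CausalLI f) (hg : CausalLI g)
    (hb : ∀ T, ∃ C, ∀ t ≤ T, |g t| ≤ C) (x : ℝ) : LConvAt f g x := by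
  obtain ⟨C, hC⟩ := hb x
  rw [lConvAt_iff]
  refine ((hf.integrable_indicator_Iic x).norm.mul_const C).mono' ?_
    (Eventually.of_forall fun t => ?_)
  · exact hf.measurable.mul ((hg.measurable.comp_quasiMeasurePreserving
      (quasiMeasurePreserving_sub_left_of_right_invariant volume x)))
  · by_cases ht : t ∈ Ioo 0 x
    · rw [indicator_of_mem (mem_Iic.2 ht.2.le), norm_mul]
      exact mul_le_mul_of_nonneg_left (hC _ (by linarith [ht.1])) (norm_nonneg _)
    · rw [mul_eq_zero_of_notMem_Ioo hf.causal hg.causal ht, norm_zero]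
      exact mul_nonneg (norm_nonneg _) ((abs_nonneg _).trans (hC x le_rfl))

theorem bounded_of_continuous (h0 : ∀ t ≤ 0, g t = 0) (h : Continuous g) (T : ℝ) :
    ∃ C, ∀ t ≤ T, |g t| ≤ C := by
  obtain ⟨C, hC⟩ := isCompact_Icc.exists_bound_of_continuousOn (s := Icc 0 T) h.continuousOn
  refine ⟨max C 0, fun t ht => ?_⟩
  rcases le_total t 0 with h1 | h1
  · simp [h0 t h1]
  · exact (hC t ⟨h1, ht⟩).trans (le_max_left _ _)

/-- Associativity at a point of absolute convergence. It is applied with kernels as the right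
factors, so that the hypothesis concerns a single kernel after `lconv_rlKernel`. -/
theorem lconv_assoc (hf : CausalLI f) (hg : CausalLI g) (hk : CausalLI k) {x : ℝ}
    (h : LConvAt (fun t => |f t|) ((fun t => |g t|) ⊛ (fun t => |k t|)) x) :
    ((f ⊛ g) ⊛ k) x = (f ⊛ (g ⊛ k)) x :=
  convolution_assoc _ _ _ _ (fun a b c => mul_assoc a b c) hf.measurable hg.measurable
    hk.measurable (hf.ae_lConvAt hg) (hg.abs.ae_lConvAt hk.abs) h

/-- If `f ⊛ (g ⊛ k)` converges absolutely at `x`, then so does `(f ⊛ g) ⊛ k`. -/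
theorem lConvAt_lconv_left (hf : CausalLI f) (hg : CausalLI g) (hk : CausalLI k) {x : ℝ}
    (h : LConvAt (fun t => |f t|) ((fun t => |g t|) ⊛ (fun t => |k t|)) x) :
    LConvAt (f ⊛ g) k x := by
  have hmeas : AEStronglyMeasurable (fun p : ℝ × ℝ => f p.2 * g (p.1 - p.2) * k (x - p.1))
      (volume.prod volume) :=
    (hf.measurable.convolution_integrand (ContinuousLinearMap.mul ℝ ℝ) hg.measurable).mul
      ((hk.measurable.comp_quasiMeasurePreserving
        (quasiMeasurePreserving_sub_left_of_right_invariant volume x)).comp_fst)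
  have hshift (a b : ℝ → ℝ) (s : ℝ) :
      (∫ t, a (t - s) * b (x - t)) = ∫ u, a u * b (x - s - u) := by
    rw [← integral_sub_right_eq_self (fun u => a u * b (x - s - u)) s]
    congr 1 with t
    ring_nf
  have hint : Integrable (fun p : ℝ × ℝ => f p.2 * g (p.1 - p.2) * k (x - p.1))
      (volume.prod volume) := by
    rw [integrable_prod_iff' hmeas]
    constructor
    · have := (quasiMeasurePreserving_sub_left_of_right_invariant (volume : Measure ℝ) x).ae
        (hg.ae_lConvAt hk)
      filter_upwards [this] with s hs
      rw [lConvAt_iff] at hs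
      convert! (hs.comp_sub_right s).const_mul (f s) using 2 with t
      ring_nf
    · rw [lConvAt_iff] at h
      convert! h using 2 with s
      simp only [norm_mul, mul_assoc, Real.norm_eq_abs]
      rw [integral_const_mul]
      congr 1
      exact hshift (fun t => |g t|) (fun t => |k t|) s
  have := hint.integral_prod_left
  rw [lConvAt_iff]
  convert! this using 2 with t
  rw [lconv_apply]
  exact (integral_mul_const _ _).symm

/-- The convolution product of a causal locally integrable and a continuous causal function is
continuous. -/
theorem continuous_lconv (hf : CausalLI f) (h0 : ∀ t ≤ 0, g t = 0) (hg : Continuous g) :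
    Continuous (f ⊛ g) := by
  refine continuous_iff_continuousAt.2 fun x => ?_
  set n : ℝ := x + 1
  have hgc : Continuous (fun t => g (min t n)) := hg.comp (continuous_id.min continuous_const)
  have hb : BddAbove (range fun t => ‖g (min t n)‖) := by
    obtain ⟨C, hC⟩ := bounded_of_continuous h0 hg n
    exact ⟨C, by rintro _ ⟨t, rfl⟩; exact hC _ (min_le_right _ _)⟩
  have h := hb.continuous_convolution_right_of_integrable (ContinuousLinearMap.mul ℝ ℝ)
    (hf.integrable_indicator_Iic n) hgc
  refine h.continuousAt.congr ?_
  filter_upwards [Iio_mem_nhds (show x < n by simp [n])] with y hy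
  refine integral_congr_ae (Eventually.of_forall fun t => ?_)
  simp only [ContinuousLinearMap.mul_apply']
  rcases le_or_gt t 0 with ht | ht
  · simp [indicator_apply, hf.causal t ht]
  · have : y - t ≤ n := by linarith [mem_Iio.1 hy]
    rw [min_eq_left this]
    by_cases ht' : t ≤ n
    · simp [ht']
    · rw [h0 (y - t) (by linarith [mem_Iio.1 hy])]
      simp

end CausalLI

/-! ### The Riemann-Liouville kernels -/

/-- The causal kernel `t ^ (b - 1) / Γ(b)` of the fractional integral of order `b`. -/
noncomputable def rlKernel (b t : ℝ) : ℝ := if 0 < t then t ^ (b - 1) / Real.Gamma b else 0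

theorem rlKernel_of_pos (b : ℝ) {t : ℝ} (ht : 0 < t) :
    rlKernel b t = t ^ (b - 1) / Real.Gamma b := if_pos ht

theorem rlKernel_of_nonpos (b : ℝ) {t : ℝ} (ht : t ≤ 0) : rlKernel b t = 0 := if_neg ht.not_gt

theorem rlKernel_one_of_pos {t : ℝ} (ht : 0 < t) : rlKernel 1 t = 1 := by
  simp [rlKernel_of_pos, ht]

theorem rlKernel_two_of_pos {t : ℝ} (ht : 0 < t) : rlKernel 2 t = t := by
  rw [rlKernel_of_pos _ ht, show (2 : ℝ) - 1 = 1 by norm_num, Real.Gamma_two, Real.rpow_one,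
    div_one]

theorem rlKernel_nonneg {b : ℝ} (hb : 0 < b) (t : ℝ) : 0 ≤ rlKernel b t := by
  rw [rlKernel]
  split_ifs with h
  · exact div_nonneg (Real.rpow_nonneg h.le _) (Real.Gamma_pos_of_pos hb).le
  · rfl

theorem abs_rlKernel {b : ℝ} (hb : 0 < b) : (fun t => |rlKernel b t|) = rlKernel b :=
  funext fun t => abs_of_nonneg (rlKernel_nonneg hb t)

theorem causalLI_rlKernel {b : ℝ} (hb : 0 < b) : CausalLI (rlKernel b) := by
  refine CausalLI.of_intervalIntegrable (fun t ht => rlKernel_of_nonpos b ht) fun T hT => ?_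
  refine ((intervalIntegral.intervalIntegrable_rpow' (show -1 < b - 1 by linarith)
    (a := 0) (b := T)).div_const (Real.Gamma b)).congr ?_
  intro t ht
  rw [uIoc_of_le hT.le] at ht
  exact (rlKernel_of_pos b ht.1).symm

theorem continuous_rlKernel {b : ℝ} (hb : 1 < b) : Continuous (rlKernel b) := by
  have h : rlKernel b = fun t => (max t 0) ^ (b - 1) / Real.Gamma b := by
    funext t
    rcases lt_or_ge 0 t with ht | ht
    · rw [rlKernel_of_pos b ht, max_eq_left ht.le]
    · rw [rlKernel_of_nonpos b ht, max_eq_right ht, Real.zero_rpow (by linarith), zero_div]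
  rw [h]
  exact ((continuous_id.max continuous_const).rpow_const
    fun _ => Or.inr (by linarith)).div_const _

theorem continuousAt_rlKernel (b : ℝ) {t : ℝ} (ht : t ≠ 0) : ContinuousAt (rlKernel b) t := by
  rcases lt_or_gt_of_ne ht with h | h
  · refine continuousAt_const.congr (f := fun _ => (0 : ℝ)) ?_
    filter_upwards [Iio_mem_nhds h] with s hs
    exact (rlKernel_of_nonpos b (le_of_lt hs)).symm
  · refine ((Real.continuousAt_rpow_const t (b - 1) (Or.inl ht)).div_const
      (Real.Gamma b)).congr ?_
    filter_upwards [Ioi_mem_nhds h] with s hs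
    exact (rlKernel_of_pos b hs).symm

theorem monotone_rlKernel {b : ℝ} (hb : 1 ≤ b) : Monotone (rlKernel b) := by
  intro s t hst
  rcases lt_or_ge 0 s with hs | hs
  · rw [rlKernel_of_pos b hs, rlKernel_of_pos b (hs.trans_le hst)]
    have := Real.Gamma_pos_of_pos (show 0 < b by linarith)
    gcongr
  · rw [rlKernel_of_nonpos b hs]
    exact rlKernel_nonneg (by linarith) t

/-- The kernels of order at least `1` are dominated by exponentials. The factor `l ^ (1 - b)`
makes series of such kernels converge geometrically. -/
theorem rlKernel_le_exp {b l : ℝ} (hb : 1 ≤ b) (hl : 0 < l) (t : ℝ) :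
    rlKernel b t ≤ Real.exp (l * t) * l ^ (1 - b) := by
  rcases le_or_gt t 0 with ht | ht
  · rw [rlKernel_of_nonpos b ht]
    positivity
  have hb0 : 0 < b := by linarith
  set x := l * t with hx
  have hx0 : 0 < x := by positivity
  have hkey : x ^ (b - 1) * Real.exp (-x) ≤ Real.Gamma b := by
    rw [Real.Gamma_eq_integral hb0]
    have h1 : IntegrableOn (fun u : ℝ => Real.exp (-u) * u ^ (b - 1)) (Ioi 0) :=
      Real.GammaIntegral_convergent hb0
    have h2 : IntegrableOn (fun u : ℝ => Real.exp (-u) * x ^ (b - 1)) (Ioi x) :=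
      (integrableOn_exp_neg_Ioi x).mul_const _
    calc x ^ (b - 1) * Real.exp (-x) = ∫ u in Ioi x, Real.exp (-u) * x ^ (b - 1) := by
          rw [integral_mul_const, integral_exp_neg_Ioi, mul_comm]
      _ ≤ ∫ u in Ioi x, Real.exp (-u) * u ^ (b - 1) := by
          refine setIntegral_mono_on h2 (h1.mono_set (Ioi_subset_Ioi hx0.le)) measurableSet_Ioi ?_
          intro u hu
          have : x ≤ u := le_of_lt hu
          have hb1 : 0 ≤ b - 1 := by linarith
          gcongr
      _ ≤ ∫ u in Ioi 0, Real.exp (-u) * u ^ (b - 1) := by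
          refine setIntegral_mono_set h1 ?_ (Ioi_subset_Ioi hx0.le).eventuallyLE
          filter_upwards [ae_restrict_mem measurableSet_Ioi] with u hu
          have : (0 : ℝ) < u := hu
          simp only [Pi.zero_apply]
          positivity
  rw [rlKernel_of_pos b ht, div_le_iff₀ (Real.Gamma_pos_of_pos hb0)]
  have hx' : x ^ (b - 1) = l ^ (b - 1) * t ^ (b - 1) := Real.mul_rpow hl.le ht.le
  have hl1 : l ^ (1 - b) * l ^ (b - 1) = 1 := by
    rw [← Real.rpow_add hl]
    simp
  have hexp : Real.exp x * Real.exp (-x) = 1 := by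
    rw [← Real.exp_add]
    simp
  calc t ^ (b - 1) = Real.exp x * l ^ (1 - b) * (x ^ (b - 1) * Real.exp (-x)) := by
        rw [hx']
        linear_combination (-t ^ (b - 1)) * hexp - t ^ (b - 1) * (Real.exp x * Real.exp (-x)) * hl1
    _ ≤ Real.exp x * l ^ (1 - b) * Real.Gamma b := by gcongr

theorem rlKernel_mul (b : ℝ) {r : ℝ} (hr : 0 < r) (t : ℝ) :
    rlKernel b (r * t) = r ^ (b - 1) * rlKernel b t := by
  rcases le_or_gt t 0 with ht | ht
  · rw [rlKernel_of_nonpos b ht, rlKernel_of_nonpos b (mul_nonpos_of_nonneg_of_nonpos hr.le ht),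
      mul_zero]
  · rw [rlKernel_of_pos b ht, rlKernel_of_pos b (mul_pos hr ht), Real.mul_rpow hr.le ht.le,
      mul_div_assoc]

theorem lConvAt_rlKernel {a b : ℝ} (ha : 0 < a) (hb : 0 < b) (x : ℝ) :
    LConvAt (rlKernel a) (rlKernel b) x := by
  rcases le_or_gt x 0 with hx | hx
  · rw [lConvAt_iff]
    refine (integrable_zero ℝ ℝ volume).congr (Eventually.of_forall fun t => ?_)
    refine (mul_eq_zero_of_notMem_Ioo (fun t ht => rlKernel_of_nonpos a ht)
      (fun t ht => rlKernel_of_nonpos b ht) ?_).symm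
    rw [Ioo_eq_empty hx.not_gt]
    exact notMem_empty t
  -- the integral converges for almost every `x`, hence for some `x > 0`, hence by scaling for all
  obtain ⟨y, hy, hy0⟩ : ∃ y, LConvAt (rlKernel a) (rlKernel b) y ∧ 0 < y := by
    have hne : (ae (volume.restrict (Ioi (0 : ℝ)))).NeBot := ae_restrict_neBot.2 (by simp)
    exact ((ae_restrict_of_ae ((causalLI_rlKernel ha).ae_lConvAt (causalLI_rlKernel hb))).and
      (ae_restrict_mem measurableSet_Ioi)).exists
  rw [lConvAt_iff] at *
  have hr : 0 < y / x := by positivity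
  have h := (hy.comp_mul_left' hr.ne').const_mul (((y / x) ^ (a - 1) * (y / x) ^ (b - 1))⁻¹)
  refine h.congr (Eventually.of_forall fun t => ?_)
  have e : y - y / x * t = y / x * (x - t) := by field_simp
  have h1 : (y / x) ^ (a - 1) ≠ 0 := (Real.rpow_pos_of_pos hr _).ne'
  have h2 : (y / x) ^ (b - 1) ≠ 0 := (Real.rpow_pos_of_pos hr _).ne'
  simp only [e, rlKernel_mul _ hr]
  field_simp

theorem lconv_rlKernel {a b : ℝ} (ha : 0 < a) (hb : 0 < b) :
    rlKernel a ⊛ rlKernel b = rlKernel (a + b) := by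
  funext x
  rcases le_or_gt x 0 with hx | hx
  · rw [rlKernel_of_nonpos _ hx, lconv_of_nonpos (fun t ht => rlKernel_of_nonpos a ht)
      (fun t ht => rlKernel_of_nonpos b ht) hx]
  rw [lconv_eq_intervalIntegral (fun t ht => rlKernel_of_nonpos a ht)
      (fun t ht => rlKernel_of_nonpos b ht) hx.le]
  have hbeta : (∫ t in (0 : ℝ)..x, t ^ (a - 1) * (x - t) ^ (b - 1)) =
      x ^ (a + b - 1) * (Real.Gamma a * Real.Gamma b / Real.Gamma (a + b)) := by
    have h := Complex.betaIntegral_scaled (a : ℂ) (b : ℂ) hx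
    rw [Complex.betaIntegral_eq_Gamma_mul_div _ _ (by simpa) (by simpa), ← Complex.ofReal_add,
      Complex.Gamma_ofReal, Complex.Gamma_ofReal, Complex.Gamma_ofReal] at h
    have h2 : (∫ t in (0 : ℝ)..x, (t : ℂ) ^ ((a : ℂ) - 1) * ((x : ℂ) - t) ^ ((b : ℂ) - 1)) =
        ∫ t in (0 : ℝ)..x, ((t ^ (a - 1) * (x - t) ^ (b - 1) : ℝ) : ℂ) := by
      refine intervalIntegral.integral_congr fun t ht => ?_
      rw [uIcc_of_le hx.le] at ht
      rw [Complex.ofReal_mul, Complex.ofReal_cpow ht.1, Complex.ofReal_cpow (by linarith [ht.2])]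
      push_cast
      rfl
    rw [h2, intervalIntegral.integral_ofReal] at h
    have h3 : (x : ℂ) ^ (((a + b : ℝ) : ℂ) - 1) = ((x ^ (a + b - 1) : ℝ) : ℂ) := by
      rw [Complex.ofReal_cpow hx.le]
      push_cast
      rfl
    rw [h3] at h
    exact_mod_cast h
  have hint : (∫ t in (0 : ℝ)..x, rlKernel a t * rlKernel b (x - t)) =
      ∫ t in (0 : ℝ)..x, t ^ (a - 1) * (x - t) ^ (b - 1) * (Real.Gamma a * Real.Gamma b)⁻¹ := by
    rw [intervalIntegral.integral_of_le hx.le, intervalIntegral.integral_of_le hx.le,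
      integral_Ioc_eq_integral_Ioo, integral_Ioc_eq_integral_Ioo]
    refine setIntegral_congr_fun measurableSet_Ioo fun t ht => ?_
    rw [rlKernel_of_pos a ht.1, rlKernel_of_pos b (by linarith [ht.2])]
    field_simp
  have h1 := (Real.Gamma_pos_of_pos ha).ne'
  have h2 := (Real.Gamma_pos_of_pos hb).ne'
  rw [hint, intervalIntegral.integral_mul_const, hbeta, rlKernel_of_pos _ hx]
  field_simp

/-! ### The delay operator and its resolvent kernels -/

/-- The operator `f ↦ c f + h f(· - τ)` on functions on the line. -/
def delayOp (τ c h : ℝ) : Module.End ℝ (ℝ → ℝ) :=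
  c • (1 : Module.End ℝ (ℝ → ℝ)) + h • LinearMap.funLeft ℝ ℝ (fun t : ℝ => t - τ)

theorem delayOp_apply (τ c h : ℝ) (f : ℝ → ℝ) (t : ℝ) :
    delayOp τ c h f t = c * f t + h * f (t - τ) := rfl

theorem delayOp_pow_apply (τ c h : ℝ) (N : ℕ) (f : ℝ → ℝ) (t : ℝ) :
    (delayOp τ c h ^ N) f t =
      ∑ m ∈ Finset.range (N + 1), (N.choose m : ℝ) * h ^ m * c ^ (N - m) * f (t - τ * m) := by
  set S : Module.End ℝ (ℝ → ℝ) := LinearMap.funLeft ℝ ℝ (fun t : ℝ => t - τ) with hS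
  have hSpow (m : ℕ) (f : ℝ → ℝ) (t : ℝ) : (S ^ m) f t = f (t - τ * m) := by
    induction m generalizing t with
    | zero => simp
    | succ m ih =>
      rw [pow_succ', Module.End.mul_apply]
      change (S ^ m) f (t - τ) = _
      rw [ih]
      push_cast
      ring_nf
  have hcomm : Commute (h • S) (c • (1 : Module.End ℝ (ℝ → ℝ))) :=
    ((Commute.one_right S).smul_left h).smul_right c
  rw [delayOp, add_comm, hcomm.add_pow, LinearMap.sum_apply, Finset.sum_apply]
  refine Finset.sum_congr rfl fun m _ => ?_
  rw [smul_pow, smul_pow, one_pow, ← hSpow m f t]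
  simp only [Module.End.mul_apply, LinearMap.smul_apply, Module.End.natCast_apply,
    Module.End.one_apply, map_smul, map_nsmul, Pi.smul_apply, smul_eq_mul]
  ring

section delayOp

variable {τ c h : ℝ} {f g : ℝ → ℝ}

theorem delayOp_of_nonpos (hτ : 0 ≤ τ) (hf : ∀ t ≤ 0, f t = 0) {t : ℝ} (ht : t ≤ 0) :
    delayOp τ c h f t = 0 := by
  rw [delayOp_apply, hf t ht, hf _ (by linarith), mul_zero, mul_zero, add_zero]

theorem CausalLI.delayOp (hτ : 0 ≤ τ) (hf : CausalLI f) : CausalLI (delayOp τ c h f) :=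
  (hf.const_mul c).add ((hf.shift hτ).const_mul h)

theorem continuous_delayOp (hf : Continuous f) : Continuous (delayOp τ c h f) :=
  (continuous_const.mul hf).add
    (continuous_const.mul (hf.comp (continuous_id.sub continuous_const)))

theorem LConvAt.delayOp {x : ℝ} (h₁ : LConvAt f g x) (h₂ : LConvAt f g (x - τ)) :
    LConvAt (delayOp τ c h f) g x :=
  (h₁.const_mul_left c).add_left (h₂.shift_left.const_mul_left h)

/-- The delay operator commutes with convolution. -/
theorem lconv_delayOp {x : ℝ} (h₁ : LConvAt f g x) (h₂ : LConvAt f g (x - τ)) :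
    (delayOp τ c h f ⊛ g) x = delayOp τ c h (f ⊛ g) x := by
  refine (lconv_add_left (h₁.const_mul_left c) (h₂.shift_left.const_mul_left h)).trans ?_
  rw [lconv_const_mul_left, lconv_const_mul_left, lconv_shift_left, delayOp_apply]

/-- Monotonicity of `g` absorbs the shifts, so that the operator acts as multiplication by
`|c| + |h|`. -/
theorem abs_delayOp_pow_le (hτ : 0 ≤ τ) (hg : Monotone g) (h0 : ∀ t, 0 ≤ g t) (N : ℕ) (t : ℝ) :
    |(_root_.delayOp τ c h ^ N) g t| ≤ (|c| + |h|) ^ N * g t := by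
  induction N generalizing t with
  | zero => simp [abs_of_nonneg (h0 t)]
  | succ N ih =>
    rw [pow_succ', Module.End.mul_apply, delayOp_apply]
    have h1 := ih t
    have h2 : |(_root_.delayOp τ c h ^ N) g (t - τ)| ≤ (|c| + |h|) ^ N * g t :=
      (ih _).trans (by gcongr; exact hg (by linarith))
    calc _ ≤ |c| * |(_root_.delayOp τ c h ^ N) g t|
          + |h| * |(_root_.delayOp τ c h ^ N) g (t - τ)| := by
          rw [← abs_mul, ← abs_mul]
          exact abs_add_le _ _
      _ ≤ |c| * ((|c| + |h|) ^ N * g t) + |h| * ((|c| + |h|) ^ N * g t) := by gcongr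
      _ = _ := by ring

end delayOp

/-- The `N`-th term of the Neumann series defining `delayKernel`. -/
noncomputable def delayTerm (α τ c h b : ℝ) (N : ℕ) : ℝ → ℝ :=
  (delayOp τ c h ^ N) (rlKernel (α * N + b))

/-- The resolvent kernel `∑ N, (c + h shift) ^ N (k_{α N + b})`, where `k` denotes the
Riemann-Liouville kernels. -/
noncomputable def delayKernel (α τ c h b t : ℝ) : ℝ := ∑' N, delayTerm α τ c h b N t

section delayKernel

variable {α τ c h : ℝ}

theorem delayTerm_zero (b : ℝ) : delayTerm α τ c h b 0 = rlKernel b := by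
  simp [delayTerm]

theorem delayTerm_succ (b : ℝ) (N : ℕ) :
    delayTerm α τ c h b (N + 1) = delayOp τ c h (delayTerm α τ c h (b + α) N) := by
  rw [delayTerm, delayTerm, pow_succ', Module.End.mul_apply]
  have e : α * ((N + 1 : ℕ) : ℝ) + b = α * N + (b + α) := by
    push_cast
    ring
  rw [e]

/-- Induction on the order `b` of a kernel, downwards in steps of `α`. -/
theorem order_induction (hα : 0 < α) {P : ℝ → Prop} (h2 : ∀ b, 2 ≤ b → P b)
    (hs : ∀ b, 0 < b → P (b + α) → P b) : ∀ b, 0 < b → P b := by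
  have key : ∀ n : ℕ, ∀ b, 0 < b → 2 ≤ b + n * α → P b := by
    intro n
    induction n with
    | zero => intro b _ hb; exact h2 b (by simpa using hb)
    | succ n ih =>
      intro b hb hb2
      refine hs b hb (ih _ (by linarith) ?_)
      push_cast at hb2
      linarith
  intro b hb
  obtain ⟨n, hn⟩ := exists_nat_ge (2 / α)
  refine key n b hb ?_
  have := (div_le_iff₀ hα).1 hn
  linarith

theorem abs_delayTerm_le (hα : 0 < α) (hτ : 0 < τ) {b : ℝ} (hb : 1 ≤ b) (N : ℕ) (t : ℝ) :
    |delayTerm α τ c h b N t| ≤ (|c| + |h|) ^ N * rlKernel (α * N + b) t := by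
  have h0 : 0 ≤ α * (N : ℝ) := by positivity
  exact abs_delayOp_pow_le hτ.le (monotone_rlKernel (by linarith))
    (rlKernel_nonneg (by linarith)) N t

/-- The comparison series is geometric: with `l ^ α = M + 1` its ratio is `M / (M + 1)`. -/
theorem exists_summable_bound (hα : 0 < α) {b : ℝ} (hb : 1 ≤ b) {M : ℝ} (hM : 0 ≤ M) (T : ℝ) :
    ∃ u : ℕ → ℝ, Summable u ∧ ∀ N : ℕ, ∀ t ≤ T, M ^ N * rlKernel (α * N + b) t ≤ u N := by
  set l : ℝ := (M + 1) ^ (1 / α) with hl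
  have hl0 : 0 < l := Real.rpow_pos_of_pos (by linarith) _
  have hlα : l ^ α = M + 1 := by
    rw [hl, ← Real.rpow_mul (by linarith), one_div_mul_cancel hα.ne', Real.rpow_one]
  refine ⟨fun N => Real.exp (l * T) * l ^ (1 - b) * (M / (M + 1)) ^ N, ?_, fun N t ht => ?_⟩
  · refine (summable_geometric_of_lt_one (by positivity) ?_).mul_left _
    rw [div_lt_one (by linarith)]
    linarith
  · have h1 := rlKernel_le_exp (b := α * N + b) (by nlinarith [(N.cast_nonneg : (0 : ℝ) ≤ N)]) hl0 t
    have h2 : l ^ (1 - (α * N + b)) = l ^ (1 - b) * ((M + 1) ^ N)⁻¹ := by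
      rw [← hlα, ← Real.rpow_natCast, ← Real.rpow_mul hl0.le, ← Real.rpow_neg hl0.le,
        ← Real.rpow_add hl0]
      ring_nf
    have h3 : Real.exp (l * t) ≤ Real.exp (l * T) := by gcongr
    rw [h2] at h1
    calc M ^ N * rlKernel (α * N + b) t
        ≤ M ^ N * (Real.exp (l * t) * (l ^ (1 - b) * ((M + 1) ^ N)⁻¹)) := by gcongr
      _ ≤ M ^ N * (Real.exp (l * T) * (l ^ (1 - b) * ((M + 1) ^ N)⁻¹)) := by gcongr
      _ = _ := by simp only [div_pow]; ring

theorem summable_pow_mul_rlKernel (hα : 0 < α) {b : ℝ} (hb : 0 < b) {M : ℝ} (hM : 0 ≤ M) (t : ℝ) :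
    Summable fun N : ℕ => M ^ N * rlKernel (α * N + b) t := by
  refine order_induction hα (P := fun b => Summable fun N : ℕ => M ^ N * rlKernel (α * N + b) t)
    (fun b hb => ?_) (fun b hb ih => ?_) b hb
  · obtain ⟨u, hu, hle⟩ := exists_summable_bound hα (show 1 ≤ b by linarith) hM t
    refine hu.of_nonneg_of_le (fun N => ?_) fun N => hle N t le_rfl
    have : 0 ≤ α * (N : ℝ) := by positivity
    exact mul_nonneg (by positivity) (rlKernel_nonneg (by linarith) t)
  · rw [← summable_nat_add_iff 1]
    refine (ih.mul_left M).congr fun N => ?_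
    push_cast
    rw [pow_succ']
    ring_nf

theorem summable_delayTerm (hα : 0 < α) (hτ : 0 < τ) {b : ℝ} (hb : 0 < b) (t : ℝ) :
    Summable fun N => delayTerm α τ c h b N t := by
  refine order_induction hα (P := fun b => ∀ t, Summable fun N => delayTerm α τ c h b N t)
    (fun b hb t => ?_) (fun b hb ih t => ?_) b hb t
  · exact (summable_pow_mul_rlKernel hα (by linarith) (by positivity) t).of_norm_bounded
      fun N => abs_delayTerm_le hα hτ (by linarith) N t
  · rw [← summable_nat_add_iff 1]
    simp only [delayTerm_succ, delayOp_apply]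
    exact ((ih t).mul_left c).add ((ih (t - τ)).mul_left h)

/-- The Volterra equation of the resolvent kernels. -/
theorem delayKernel_eq (hα : 0 < α) (hτ : 0 < τ) {b : ℝ} (hb : 0 < b) :
    delayKernel α τ c h b =
      fun t => rlKernel b t + delayOp τ c h (delayKernel α τ c h (b + α)) t := by
  funext t
  rw [delayKernel, (summable_delayTerm hα hτ hb t).tsum_eq_zero_add, delayTerm_zero]
  simp only [delayTerm_succ, delayOp_apply, delayKernel]
  have hba : 0 < b + α := by linarith
  rw [((summable_delayTerm hα hτ hba t).mul_left c).tsum_add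
    ((summable_delayTerm hα hτ hba (t - τ)).mul_left h), tsum_mul_left, tsum_mul_left]

theorem delayTerm_of_nonpos (hτ : 0 < τ) (b : ℝ) (N : ℕ) {t : ℝ} (ht : t ≤ 0) :
    delayTerm α τ c h b N t = 0 := by
  induction N generalizing b t with
  | zero => rw [delayTerm_zero, rlKernel_of_nonpos b ht]
  | succ N ih =>
    rw [delayTerm_succ]
    exact delayOp_of_nonpos hτ.le (fun t ht => ih _ ht) ht

theorem delayKernel_of_nonpos (hτ : 0 < τ) (b : ℝ) {t : ℝ} (ht : t ≤ 0) :
    delayKernel α τ c h b t = 0 := by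
  simp [delayKernel, delayTerm_of_nonpos hτ b _ ht]

theorem continuous_delayTerm (hα : 0 < α) {b : ℝ} (hb : 1 < b) (N : ℕ) :
    Continuous (delayTerm α τ c h b N) := by
  induction N generalizing b with
  | zero => rw [delayTerm_zero]; exact continuous_rlKernel hb
  | succ N ih => rw [delayTerm_succ]; exact continuous_delayOp (ih (by linarith))

theorem continuous_delayKernel (hα : 0 < α) (hτ : 0 < τ) {b : ℝ} (hb : 1 < b) :
    Continuous (delayKernel α τ c h b) := by
  refine continuous_iff_continuousAt.2 fun t => ?_
  obtain ⟨u, hu, hle⟩ := exists_summable_bound hα hb.le (M := |c| + |h|) (by positivity) (t + 1)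
  have : ContinuousOn (delayKernel α τ c h b) (Iic (t + 1)) :=
    continuousOn_tsum (fun N => (continuous_delayTerm hα hb N).continuousOn) hu
      fun N s hs => (abs_delayTerm_le hα hτ hb.le N s).trans (hle N s hs)
  exact this.continuousAt (Iic_mem_nhds (by linarith))

theorem causalLI_delayKernel (hα : 0 < α) (hτ : 0 < τ) {b : ℝ} (hb : 0 < b) :
    CausalLI (delayKernel α τ c h b) := by
  refine order_induction hα (P := fun b => CausalLI (delayKernel α τ c h b))
    (fun b hb => ?_) (fun b hb ih => ?_) b hb
  · exact .of_continuous (fun t ht => delayKernel_of_nonpos hτ b ht)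
      (continuous_delayKernel hα hτ (by linarith))
  · rw [delayKernel_eq hα hτ hb]
    exact (causalLI_rlKernel hb).add (ih.delayOp hτ.le)

theorem continuousAt_delayOp {f : ℝ → ℝ} (hf : ∀ t, (∀ m : ℕ, t ≠ m * τ) → ContinuousAt f t)
    {t : ℝ} (ht : ∀ m : ℕ, t ≠ m * τ) : ContinuousAt (delayOp τ c h f) t := by
  have h2 : ContinuousAt f (t - τ) := by
    refine hf _ fun m hm => ht (m + 1) ?_
    push_cast
    linarith
  exact (continuousAt_const.mul (hf t ht)).add
    (continuousAt_const.mul (h2.comp (f := fun s => s - τ)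
      (continuous_id.sub continuous_const).continuousAt))

/-- Away from the multiples of the delay the resolvent kernels are continuous. -/
theorem continuousAt_delayKernel (hα : 0 < α) (hτ : 0 < τ) {b : ℝ} (hb : 0 < b) {t : ℝ}
    (ht : ∀ m : ℕ, t ≠ m * τ) : ContinuousAt (delayKernel α τ c h b) t := by
  refine order_induction hα (P := fun b => ∀ t, (∀ m : ℕ, t ≠ m * τ) →
    ContinuousAt (delayKernel α τ c h b) t) (fun b hb t _ => ?_) (fun b hb ih t ht => ?_) b hb t ht
  · exact (continuous_delayKernel hα hτ (by linarith)).continuousAt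
  · rw [delayKernel_eq hα hτ hb]
    exact (continuousAt_rlKernel b (by simpa using ht 0)).add (continuousAt_delayOp ih ht)

theorem lconv_delayTerm (hα : 0 < α) {b β : ℝ} (hb : 0 < b) (hβ : 0 < β) (N : ℕ) :
    (∀ x, LConvAt (delayTerm α τ c h b N) (rlKernel β) x) ∧
      delayTerm α τ c h b N ⊛ rlKernel β = delayTerm α τ c h (b + β) N := by
  induction N generalizing b with
  | zero =>
    simp only [delayTerm_zero]
    exact ⟨lConvAt_rlKernel hb hβ, lconv_rlKernel hb hβ⟩
  | succ N ih =>
    obtain ⟨h1, h2⟩ := ih (show 0 < b + α by linarith)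
    simp only [delayTerm_succ]
    refine ⟨fun x => (h1 x).delayOp (h1 _), funext fun x => ?_⟩
    rw [lconv_delayOp (h1 x) (h1 _), h2]
    ring_nf

/-- Fractional integration of order `β` raises the order of the resolvent kernels by `β`. -/
theorem lconv_delayKernel (hα : 0 < α) (hτ : 0 < τ) {b β : ℝ} (hb : 0 < b) (hβ : 0 < β) :
    (∀ x, LConvAt (delayKernel α τ c h b) (rlKernel β) x) ∧
      delayKernel α τ c h b ⊛ rlKernel β = delayKernel α τ c h (b + β) := by
  refine order_induction hα (P := fun b =>
    (∀ x, LConvAt (delayKernel α τ c h b) (rlKernel β) x) ∧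
      delayKernel α τ c h b ⊛ rlKernel β = delayKernel α τ c h (b + β))
    (fun b hb => ?_) (fun b hb ih => ?_) b hb
  · have hb0 : 0 < b := by linarith
    refine ⟨fun x => ((causalLI_rlKernel hβ).lConvAt_of_bounded (causalLI_delayKernel hα hτ hb0)
      (CausalLI.bounded_of_continuous (fun t ht => delayKernel_of_nonpos hτ b ht)
        (continuous_delayKernel hα hτ (by linarith))) x).symm, funext fun x => ?_⟩
    have hN (N : ℕ) : 0 < α * (N : ℝ) + b := by positivity
    have hsum : Summable fun N : ℕ =>
        ∫ s, ‖delayTerm α τ c h b N s * rlKernel β (x - s)‖ := by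
      refine (summable_pow_mul_rlKernel hα (show 0 < b + β by linarith)
        (show 0 ≤ |c| + |h| by positivity) x).of_nonneg_of_le
        (fun N => integral_nonneg fun s => norm_nonneg _) fun N => ?_
      have e : rlKernel (α * N + (b + β)) x =
          ∫ s, rlKernel (α * N + b) s * rlKernel β (x - s) := by
        rw [← add_assoc, ← lconv_rlKernel (hN N) hβ]
        rfl
      rw [e, ← integral_const_mul]
      refine integral_mono (lConvAt_iff.1 ((lconv_delayTerm hα hb0 hβ N).1 x)).norm
        ((lConvAt_iff.1 (lConvAt_rlKernel (hN N) hβ x)).const_mul _) fun s => ?_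
      simp only [norm_mul, Real.norm_eq_abs, abs_of_nonneg (rlKernel_nonneg hβ _), ← mul_assoc]
      exact mul_le_mul_of_nonneg_right (abs_delayTerm_le hα hτ (by linarith) N s)
        (rlKernel_nonneg hβ _)
    have := hasSum_integral_of_summable_integral_norm
      (fun N => lConvAt_iff.1 ((lconv_delayTerm hα hb0 hβ N).1 x)) hsum
    rw [lconv_apply]
    have e : (∫ s, delayKernel α τ c h b s * rlKernel β (x - s)) =
        ∫ s, ∑' N, delayTerm α τ c h b N s * rlKernel β (x - s) :=
      integral_congr_ae (Eventually.of_forall fun s => tsum_mul_right.symm)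
    rw [e, ← this.tsum_eq, delayKernel]
    refine tsum_congr fun N => ?_
    rw [← (lconv_delayTerm hα hb0 hβ N).2]
    rfl
  · obtain ⟨h1, h2⟩ := ih
    rw [delayKernel_eq hα hτ hb, delayKernel_eq hα hτ (show 0 < b + β by linarith)]
    have h3 (x : ℝ) := lConvAt_rlKernel hb hβ x
    have h4 (x : ℝ) : LConvAt (delayOp τ c h (delayKernel α τ c h (b + α))) (rlKernel β) x :=
      (h1 x).delayOp (h1 _)
    refine ⟨fun x => (h3 x).add_left (h4 x), funext fun x => ?_⟩
    rw [lconv_add_left (h3 x) (h4 x), lconv_rlKernel hb hβ, lconv_delayOp (h1 x) (h1 _), h2]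
    ring_nf

/-- The delayed Mittag-Leffler sums are the resolvent kernels. At the multiples of the delay this
needs `1 ≤ b`: for smaller `b` a summand `(t - τ m) ^ (α m + b - 1)` may be `0 ^ 0` there. -/
theorem delayML_eq_delayKernel (hα : 0 < α) (hτ : 0 < τ) {b : ℝ} (hb : 0 < b) {t : ℝ} (ht : 0 < t)
    (h1 : 1 ≤ b ∨ ∀ m : ℕ, t ≠ m * τ) : delayML α τ c h b t = delayKernel α τ c h b t := by
  set a : ℕ → ℕ → ℝ := fun m N =>
    (N.choose m : ℝ) * h ^ m * c ^ (N - m) * rlKernel (α * N + b) (t - τ * m) with ha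
  have hterm (N : ℕ) : delayTerm α τ c h b N t = ∑ m ∈ Finset.range (⌊t / τ⌋₊ + 1), a m N := by
    have e1 : ∀ M, N + 1 ≤ M → ∑ m ∈ Finset.range M, a m N = delayTerm α τ c h b N t := by
      intro M hM
      rw [delayTerm, delayOp_pow_apply]
      refine (Finset.sum_subset (Finset.range_mono hM) fun m _ hm => ?_).symm
      have : N < m := by simpa using hm
      simp [ha, Nat.choose_eq_zero_of_lt this]
    have e2 : ∀ M, ⌊t / τ⌋₊ + 1 ≤ M →
        ∑ m ∈ Finset.range M, a m N = ∑ m ∈ Finset.range (⌊t / τ⌋₊ + 1), a m N := by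
      intro M hM
      refine (Finset.sum_subset (Finset.range_mono hM) fun m _ hm => ?_).symm
      have h2 : ⌊t / τ⌋₊ < m := by simpa using hm
      have h3 := (div_lt_iff₀ hτ).1 ((Nat.floor_lt (by positivity)).1 h2)
      simp only [ha]
      rw [rlKernel_of_nonpos _ (by linarith), mul_zero]
    rw [← e1 (max (N + 1) (⌊t / τ⌋₊ + 1)) (le_max_left _ _),
      e2 (max (N + 1) (⌊t / τ⌋₊ + 1)) (le_max_right _ _)]
  have hsummable (m : ℕ) : Summable (a m) := by
    refine (summable_pow_mul_rlKernel hα hb (show 0 ≤ |c| + |h| by positivity)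
      (t - τ * m)).of_norm_bounded fun N => ?_
    have hk : 0 ≤ rlKernel (α * N + b) (t - τ * m) := rlKernel_nonneg (by positivity) _
    rw [norm_mul, Real.norm_of_nonneg hk]
    refine mul_le_mul_of_nonneg_right ?_ hk
    rw [norm_mul, norm_mul, norm_pow, norm_pow, Real.norm_natCast, Real.norm_eq_abs,
      Real.norm_eq_abs]
    rcases le_or_gt m N with hm | hm
    · rw [add_comm, add_pow]
      refine le_trans (le_of_eq ?_) (Finset.single_le_sum
        (f := fun m => |h| ^ m * |c| ^ (N - m) * (N.choose m : ℝ)) (fun i _ => by positivity)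
        (Finset.mem_range.2 (Nat.lt_succ_of_le hm)))
      ring
    · rw [Nat.choose_eq_zero_of_lt hm]
      simp only [CharP.cast_eq_zero, zero_mul]
      positivity
  have hsum (m : ℕ) (hm : m ∈ Finset.range (⌊t / τ⌋₊ + 1)) :
      h ^ m * (t - τ * m) ^ (α * m + b - 1) *
        mittagLeffler3 α (α * m + b) (m + 1) (c * (t - τ * m) ^ α) = ∑' N, a m N := by
    have hm' : (m : ℝ) * τ ≤ t := by
      have : m ≤ ⌊t / τ⌋₊ := by
        rw [Finset.mem_range] at hm
        omega
      exact (le_div_iff₀ hτ).1 ((Nat.le_floor_iff (by positivity)).1 this)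
    rcases eq_or_lt_of_le hm' with heq | hlt
    · -- at a multiple of the delay the exponent is positive
      have hb1 : 1 ≤ b := h1.resolve_right fun h2 => h2 m heq.symm
      have h0 : t - τ * m = 0 := by linarith
      have hm0 : 0 < (m : ℝ) := by
        by_contra h3
        have : (m : ℝ) = 0 := le_antisymm (not_lt.1 h3) m.cast_nonneg
        rw [this] at heq
        linarith
      have hαm : 0 < α * m := mul_pos hα hm0
      rw [h0, Real.zero_rpow (by linarith)]
      simp [ha, h0, rlKernel_of_nonpos]
    · set s := t - τ * m with hs
      have hs0 : 0 < s := by rw [hs]; linarith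
      have hzero : ∑ N ∈ Finset.range m, a m N = 0 := Finset.sum_eq_zero fun N hN => by
        simp [ha, Nat.choose_eq_zero_of_lt (Finset.mem_range.1 hN)]
      rw [← (hsummable m).sum_add_tsum_nat_add m, hzero, zero_add, mittagLeffler3, ← tsum_mul_left]
      refine tsum_congr fun p => ?_
      have hch : ((p + m).choose m : ℝ) = (p + m).factorial / (p.factorial * m.factorial) := by
        rw [Nat.cast_choose ℝ (Nat.le_add_left m p), Nat.add_sub_cancel, mul_comm]
      have hΓ1 : Real.Gamma ((m : ℝ) + 1 + p) = (p + m).factorial := by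
        rw [← Real.Gamma_nat_eq_factorial]
        push_cast
        ring_nf
      have hΓ2 : Real.Gamma ((m : ℝ) + 1) = m.factorial := Real.Gamma_nat_eq_factorial m
      have hpow : s ^ (α * m + b - 1) * (s ^ α) ^ p = s ^ (α * ((p + m : ℕ) : ℝ) + b - 1) := by
        rw [← Real.rpow_natCast, ← Real.rpow_mul hs0.le, ← Real.rpow_add hs0]
        push_cast
        ring_nf
      have hΓ3 : α * p + (α * m + b) = α * ((p + m : ℕ) : ℝ) + b := by
        push_cast
        ring
      simp only [ha]
      rw [rlKernel_of_pos _ hs0, hch, hΓ1, hΓ2, hΓ3, ← hpow, Nat.add_sub_cancel, mul_pow]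
      have hΓ4 : Real.Gamma (α * ((p + m : ℕ) : ℝ) + b) ≠ 0 :=
        (Real.Gamma_pos_of_pos (by positivity)).ne'
      field_simp
  rw [delayML, Finset.sum_congr rfl hsum, delayKernel]
  simp only [hterm]
  exact (Summable.tsum_finsetSum fun m _ => hsummable m).symm

end delayKernel

/-! ### Volterra equations with delay -/

theorem lConvAt_rlKernel_right {f : ℝ → ℝ} (hf : CausalLI f) {b : ℝ} (hb : 1 ≤ b) (x : ℝ) :
    LConvAt f (rlKernel b) x :=
  hf.lConvAt_of_bounded (causalLI_rlKernel (by linarith))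
    (fun T => ⟨rlKernel b T, fun t ht => by
      rw [abs_of_nonneg (rlKernel_nonneg (by linarith) t)]
      exact monotone_rlKernel hb ht⟩) x

/-- The semigroup property of fractional integration, at every point once the total order is at
least `1`. -/
theorem lconv_rlKernel_lconv_rlKernel {f : ℝ → ℝ} (hf : CausalLI f) {a b : ℝ} (ha : 0 < a)
    (hb : 0 < b) (hab : 1 ≤ a + b) (x : ℝ) :
    LConvAt (f ⊛ rlKernel a) (rlKernel b) x ∧
      ((f ⊛ rlKernel a) ⊛ rlKernel b) x = (f ⊛ rlKernel (a + b)) x := by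
  have h : LConvAt (fun t => |f t|)
      ((fun t => |rlKernel a t|) ⊛ (fun t => |rlKernel b t|)) x := by
    rw [abs_rlKernel ha, abs_rlKernel hb, lconv_rlKernel ha hb]
    exact lConvAt_rlKernel_right hf.abs hab x
  rw [← lconv_rlKernel ha hb]
  exact ⟨hf.lConvAt_lconv_left (causalLI_rlKernel ha) (causalLI_rlKernel hb) h,
    hf.lconv_assoc (causalLI_rlKernel ha) (causalLI_rlKernel hb) h⟩

theorem lconv_rlKernel_one {f : ℝ → ℝ} (hf : CausalLI f) (x : ℝ) :
    (f ⊛ rlKernel 1) x = ∫ s in (0 : ℝ)..x, f s := by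
  rcases le_total x 0 with hx | hx
  · rw [lconv_of_nonpos hf.causal (fun t ht => rlKernel_of_nonpos 1 ht) hx,
      intervalIntegral.integral_symm, intervalIntegral.integral_zero_ae, neg_zero]
    refine Eventually.of_forall fun s hs => hf.causal s ?_
    rw [uIoc_of_le hx] at hs
    exact hs.2
  · rw [lconv_eq_intervalIntegral hf.causal (fun t ht => rlKernel_of_nonpos 1 ht) hx,
      intervalIntegral.integral_of_le hx, intervalIntegral.integral_of_le hx,
      integral_Ioc_eq_integral_Ioo, integral_Ioc_eq_integral_Ioo]
    refine setIntegral_congr_fun measurableSet_Ioo fun t ht => ?_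
    rw [rlKernel_one_of_pos (by linarith [ht.2]), mul_one]

theorem continuous_lconv_rlKernel_one {f : ℝ → ℝ} (hf : CausalLI f) :
    Continuous (f ⊛ rlKernel 1) := by
  rw [funext (lconv_rlKernel_one hf)]
  exact intervalIntegral.continuous_primitive (fun a b => hf.intervalIntegrable a b) 0

/-- The solution of the delayed Volterra equation with source `G` and with initial data `β`, `κ`
attached to the kernels of orders `a`, `b`. -/
noncomputable def delaySol (α τ c h : ℝ) (G : ℝ → ℝ) (β a κ b t : ℝ) : ℝ :=
  (G ⊛ delayKernel α τ c h α) t + β * delayKernel α τ c h a t + κ * delayKernel α τ c h b t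

section delaySol

variable {α τ c h β a κ b : ℝ} {G : ℝ → ℝ}

theorem causalLI_delaySol (hα : 0 < α) (hτ : 0 < τ) (ha : 0 < a) (hb : 0 < b) (hG : CausalLI G) :
    CausalLI (delaySol α τ c h G β a κ b) :=
  ((hG.lconv (causalLI_delayKernel hα hτ hα)).add
    ((causalLI_delayKernel hα hτ ha).const_mul β)).add
      ((causalLI_delayKernel hα hτ hb).const_mul κ)

/-- The Volterra equation holds at `x` as soon as the convolutions with the source that occur in it
converge absolutely there. -/
theorem delaySol_eq_of_lConvAt (hα : 0 < α) (hτ : 0 < τ) (ha : 0 < a) (hb : 0 < b)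
    (hG : CausalLI G) {x : ℝ} (h₁ : LConvAt G (rlKernel α) x)
    (h₂ : ∀ y, y = x ∨ y = x - τ → LConvAt G (delayKernel α τ c h (α + α)) y ∧
      LConvAt (fun t => |G t|)
        ((fun t => |delayKernel α τ c h α t|) ⊛ (fun t => |rlKernel α t|)) y) :
    delaySol α τ c h G β a κ b x = β * rlKernel a x + κ * rlKernel b x +
      ((fun t => G t + delayOp τ c h (delaySol α τ c h G β a κ b) t) ⊛ rlKernel α) x := by
  have hK := causalLI_delayKernel (c := c) (h := h) hα hτ hα
  have hk := causalLI_rlKernel hα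
  set u := G ⊛ delayKernel α τ c h α with hu
  obtain ⟨hx1, hx2⟩ := h₂ x (Or.inl rfl)
  obtain ⟨hy1, hy2⟩ := h₂ (x - τ) (Or.inr rfl)
  have hux : LConvAt u (rlKernel α) x := hG.lConvAt_lconv_left hK hk hx2
  have huy : LConvAt u (rlKernel α) (x - τ) := hG.lConvAt_lconv_left hK hk hy2
  have hex : (u ⊛ rlKernel α) x = (G ⊛ delayKernel α τ c h (α + α)) x := by
    rw [hu, hG.lconv_assoc hK hk hx2, (lconv_delayKernel hα hτ hα hα).2]
  have hey : (u ⊛ rlKernel α) (x - τ) = (G ⊛ delayKernel α τ c h (α + α)) (x - τ) := by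
    rw [hu, hG.lconv_assoc hK hk hy2, (lconv_delayKernel hα hτ hα hα).2]
  have hKa := lconv_delayKernel (c := c) (h := h) hα hτ ha hα
  have hKb := lconv_delayKernel (c := c) (h := h) hα hτ hb hα
  -- existence of the convolution of the solution with the kernel
  have hsol (y : ℝ) (hy : LConvAt u (rlKernel α) y) :
      LConvAt (delaySol α τ c h G β a κ b) (rlKernel α) y ∧
        (delaySol α τ c h G β a κ b ⊛ rlKernel α) y = (u ⊛ rlKernel α) y +
          β * delayKernel α τ c h (a + α) y + κ * delayKernel α τ c h (b + α) y := by
    have e1 := (hKa.1 y).const_mul_left β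
    have e2 := (hKb.1 y).const_mul_left κ
    refine ⟨(hy.add_left e1).add_left e2, ?_⟩
    refine (lconv_add_left (hy.add_left e1) e2).trans ?_
    rw [lconv_add_left hy e1, lconv_const_mul_left, lconv_const_mul_left, hKa.2, hKb.2]
  obtain ⟨hsx, hsx'⟩ := hsol x hux
  obtain ⟨hsy, hsy'⟩ := hsol (x - τ) huy
  have hGK : u x = (G ⊛ rlKernel α) x + c * (G ⊛ delayKernel α τ c h (α + α)) x +
      h * (G ⊛ delayKernel α τ c h (α + α)) (x - τ) := by
    have e1 := hx1.const_mul_right c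
    have e2 := hy1.shift_right.const_mul_right h
    rw [hu, delayKernel_eq hα hτ hα]
    refine (lconv_add_right h₁ (e1.add_right e2)).trans ?_
    refine (congrArg (_ + ·) (lconv_add_right e1 e2)).trans ?_
    rw [lconv_const_mul_right, lconv_const_mul_right, lconv_shift_right]
    ring
  have hKae := congrFun (delayKernel_eq (c := c) (h := h) hα hτ ha) x
  have hKbe := congrFun (delayKernel_eq (c := c) (h := h) hα hτ hb) x
  rw [lconv_add_left h₁ (hsx.delayOp hsy), lconv_delayOp hsx hsy, delayOp_apply, hsx', hsy', hex,
    hey]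
  have hdef : delaySol α τ c h G β a κ b x =
    u x + β * delayKernel α τ c h a x + κ * delayKernel α τ c h b x := rfl
  rw [hdef, hGK, hKae, hKbe, delayOp_apply, delayOp_apply]
  ring

theorem delaySol_ae_eq (hα : 0 < α) (hτ : 0 < τ) (ha : 0 < a) (hb : 0 < b) (hG : CausalLI G) :
    delaySol α τ c h G β a κ b =ᵐ[volume] fun x => β * rlKernel a x + κ * rlKernel b x +
      ((fun t => G t + delayOp τ c h (delaySol α τ c h G β a κ b) t) ⊛ rlKernel α) x := by
  have hK := causalLI_delayKernel (c := c) (h := h) hα hτ hα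
  have hk := causalLI_rlKernel hα
  have hP := (hG.ae_lConvAt (causalLI_delayKernel (c := c) (h := h) hα hτ
    (show 0 < α + α by linarith))).and (hG.abs.ae_lConvAt (hK.abs.lconv hk.abs))
  filter_upwards [hG.ae_lConvAt hk, hP,
    (measurePreserving_sub_right volume τ).quasiMeasurePreserving.ae hP] with x h1 h2 h3
  refine delaySol_eq_of_lConvAt hα hτ ha hb hG h1 fun y hy => ?_
  rcases hy with rfl | rfl
  · exact h2
  · exact h3

theorem delaySol_eq (hα : 0 < α) (hτ : 0 < τ) (ha : 0 < a) (hb : 0 < b) (hG : CausalLI G)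
    (hGb : ∀ T, ∃ C, ∀ t ≤ T, |G t| ≤ C) (x : ℝ) :
    delaySol α τ c h G β a κ b x = β * rlKernel a x + κ * rlKernel b x +
      ((fun t => G t + delayOp τ c h (delaySol α τ c h G β a κ b) t) ⊛ rlKernel α) x := by
  have hK := causalLI_delayKernel (c := c) (h := h) hα hτ hα
  have hk := causalLI_rlKernel hα
  refine delaySol_eq_of_lConvAt hα hτ ha hb hG (hk.lConvAt_of_bounded hG hGb x).symm
    fun y _ => ⟨((causalLI_delayKernel hα hτ (by linarith)).lConvAt_of_bounded hG hGb y).symm,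
      ((hK.abs.lconv hk.abs).lConvAt_of_bounded hG.abs (by simpa using hGb) y).symm⟩

end delaySol

/-! ### Fractional integrals as convolutions -/

theorem fracInt_eq_lconv {γ : ℝ} (hγ : 0 < γ) {f y : ℝ → ℝ} (hy : ∀ t ≤ 0, y t = 0)
    (hfy : ∀ᵐ s, 0 < s → f s = y s) {t : ℝ} (ht : 0 < t) :
    fracInt γ f t = (y ⊛ rlKernel γ) t := by
  rw [fracInt, if_neg hγ.ne', lconv_eq_intervalIntegral hy (fun t ht => rlKernel_of_nonpos γ ht)
    ht.le, ← intervalIntegral.integral_const_mul, intervalIntegral.integral_of_le ht.le,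
    intervalIntegral.integral_of_le ht.le, integral_Ioc_eq_integral_Ioo,
    integral_Ioc_eq_integral_Ioo]
  refine setIntegral_congr_ae measurableSet_Ioo ?_
  filter_upwards [hfy] with s hs hst
  rw [rlKernel_of_pos γ (by linarith [hst.2]), hs hst.1]
  ring

theorem fracIntegrable_of_lConvAt {γ : ℝ} (hγ : 0 < γ) {f y : ℝ → ℝ} (hy : ∀ t ≤ 0, y t = 0)
    (hfy : ∀ᵐ s, 0 < s → f s = y s) {t : ℝ} (ht : 0 < t) (h : LConvAt y (rlKernel γ) t) :
    FracIntegrable γ f t := by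
  right
  have h1 := ((lConvAt_iff_intervalIntegrable hy (fun t ht => rlKernel_of_nonpos γ ht) ht.le).1
    h).const_mul (Real.Gamma γ)
  rw [intervalIntegrable_iff_integrableOn_Ioo_of_le ht.le] at *
  refine h1.congr ?_
  rw [EventuallyEq, ae_restrict_iff' measurableSet_Ioo]
  filter_upwards [hfy] with s hs hst
  rw [rlKernel_of_pos γ (by linarith [hst.2]), hs hst.1]
  have := (Real.Gamma_pos_of_pos hγ).ne'
  field_simp

/-! ### Caputo derivatives -/

theorem AbsolutelyContinuousOnInterval.congr {f g : ℝ → ℝ} {a b : ℝ}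
    (hf : AbsolutelyContinuousOnInterval f a b) (hfg : EqOn f g (uIcc a b)) :
    AbsolutelyContinuousOnInterval g a b := by
  refine Tendsto.congr' ?_ hf
  filter_upwards [mem_inf_of_right (mem_principal_self _)] with E hE
  refine Finset.sum_congr rfl fun i hi => ?_
  have := hE.1 i hi
  rw [hfg this.1, hfg this.2]

theorem ceil_eq_one_of_le_one {α : ℝ} (hα : 0 < α) (hα1 : α ≤ 1) : ⌈α⌉₊ = 1 :=
  (Nat.ceil_eq_iff one_ne_zero).2 ⟨by simpa using hα, by simpa using hα1⟩

theorem ceil_eq_two_of_one_lt {α : ℝ} (hα1 : 1 < α) (hα2 : α ≤ 2) : ⌈α⌉₊ = 2 :=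
  (Nat.ceil_eq_iff two_ne_zero).2 ⟨by simpa using hα1, by simpa using hα2⟩

section criterion

variable {f D v : ℝ → ℝ} {a κ w₀ t : ℝ}

/-- If `D' = w₀ k_β + v ⊛ k_β` in the integrated sense, for an order `β ≤ 1`, then the fractional
integral of order `1 - β` of `D'` is `w₀ + ∫ v`, at every point of `(0, ∞)`. -/
theorem fracInt_deriv {β : ℝ} (hβ : 0 < β) (hβ1 : β ≤ 1) (hv : CausalLI v)
    (hD : ∀ s, 0 < s → D s = a + ((fun s => w₀ * rlKernel β s + (v ⊛ rlKernel β) s)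
      ⊛ rlKernel 1) s) (ht : 0 < t) :
    FracIntegrable (1 - β) (deriv D) t ∧ (β = 1 → DifferentiableAt ℝ D t) ∧
      fracInt (1 - β) (deriv D) t = w₀ + (v ⊛ rlKernel 1) t := by
  set q : ℝ → ℝ := fun s => w₀ * rlKernel β s + (v ⊛ rlKernel β) s with hq
  have hk := causalLI_rlKernel hβ
  have hqc : CausalLI q := (hk.const_mul w₀).add (hv.lconv hk)
  have hD' (s : ℝ) (hs : 0 < s) : D =ᶠ[𝓝 s] fun x => a + ∫ u in (0 : ℝ)..x, q u := by
    filter_upwards [Ioi_mem_nhds hs] with x hx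
    rw [hD x hx, lconv_rlKernel_one hqc]
  rcases eq_or_lt_of_le hβ1 with rfl | hlt
  · have hqcont : ContinuousAt q t :=
      (continuousAt_const.mul (continuousAt_rlKernel 1 ht.ne')).add
        (continuous_lconv_rlKernel_one hv).continuousAt
    have hder : HasDerivAt D (q t) t := by
      refine HasDerivAt.congr_of_eventuallyEq ?_ (hD' t ht)
      exact (intervalIntegral.integral_hasDerivAt_right (hqc.intervalIntegrable 0 t)
        ⟨univ, univ_mem, by simpa using hqc.measurable⟩ hqcont).const_add a
    refine ⟨Or.inl (sub_self 1), fun _ => hder.differentiableAt, ?_⟩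
    rw [fracInt, if_pos (sub_self 1), hder.deriv, hq]
    simp only
    rw [rlKernel_one_of_pos ht, mul_one]
  · have hγ : 0 < 1 - β := by linarith
    have hae : ∀ᵐ s, 0 < s → deriv D s = q s := by
      filter_upwards [LocallyIntegrable.ae_hasDerivAt_integral hqc.li] with s hs hs0
      exact (((hs 0).const_add a).congr_of_eventuallyEq (hD' s hs0)).deriv
    have h1 := (lConvAt_rlKernel hβ hγ t).const_mul_left w₀
    have h2 := lconv_rlKernel_lconv_rlKernel hv hβ hγ (by linarith) t
    refine ⟨fracIntegrable_of_lConvAt hγ hqc.causal hae ht (h1.add_left h2.1),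
      fun h => absurd h hlt.ne, ?_⟩
    rw [fracInt_eq_lconv hγ hqc.causal hae ht, hq, lconv_add_left h1 h2.1, h2.2,
      lconv_const_mul_left, lconv_rlKernel hβ hγ, add_sub_cancel, rlKernel_one_of_pos ht, mul_one]

theorem absolutelyContinuous_lconv_rlKernel_one (hv : CausalLI v) (a t : ℝ) :
    AbsolutelyContinuousOnInterval (fun s => a + (v ⊛ rlKernel 1) s) 0 t := by
  have h1 : AbsolutelyContinuousOnInterval (fun _ : ℝ => a) 0 t :=
    (contDiff_const (n := 1)).contDiffOn.absolutelyContinuousOnInterval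
  have h2 := (hv.intervalIntegrable 0 t).absolutelyContinuousOnInterval_intervalIntegral
    (c := 0) left_mem_uIcc
  rw [← funext (lconv_rlKernel_one hv)] at h2
  exact h1.add h2

/-- The right derivative at `0` and the classical derivative on `(0, ∞)` of a function whose Caputo
derivative of order `α > 1` is `w₀ + ∫ v` and whose initial velocity is `κ`. -/
noncomputable def velocity (α κ w₀ : ℝ) (v : ℝ → ℝ) (s : ℝ) : ℝ :=
  κ + ((fun s => w₀ * rlKernel (α - 1) s + (v ⊛ rlKernel (α - 1)) s) ⊛ rlKernel 1) s

theorem causalLI_velocity_source {α : ℝ} (hα : 1 < α) (hv : CausalLI v) :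
    CausalLI fun s => w₀ * rlKernel (α - 1) s + (v ⊛ rlKernel (α - 1)) s :=
  have hk := causalLI_rlKernel (sub_pos.2 hα)
  (hk.const_mul w₀).add (hv.lconv hk)

theorem continuous_velocity {α : ℝ} (hα : 1 < α) (hv : CausalLI v) :
    Continuous (velocity α κ w₀ v) :=
  continuous_const.add (continuous_lconv_rlKernel_one (causalLI_velocity_source hα hv))

theorem hasDerivAt_integral_velocity {α : ℝ} (hα : 1 < α) (hv : CausalLI v) (a s : ℝ) :
    HasDerivAt (fun s => a + ∫ u in (0 : ℝ)..s, velocity α κ w₀ v u) (velocity α κ w₀ v s) s :=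
  have hq := continuous_velocity (κ := κ) (w₀ := w₀) hα hv
  (intervalIntegral.integral_hasDerivAt_right (hq.intervalIntegrable 0 s)
    (hq.stronglyMeasurableAtFilter _ _) hq.continuousAt).const_add a

theorem eq_integral_velocity {α : ℝ} {v₁ : ℝ → ℝ} (hα : 1 < α)
    (hv : CausalLI v) (hv₁ : CausalLI v₁) (hf : ∀ s, 0 ≤ s → f s = a + (v₁ ⊛ rlKernel 1) s)
    (hrep : v₁ =ᵐ[volume] fun s => κ * rlKernel 1 s + w₀ * rlKernel α s + (v ⊛ rlKernel α) s)
    {s : ℝ} (hs : 0 ≤ s) : f s = a + ∫ u in (0 : ℝ)..s, velocity α κ w₀ v u := by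
  rw [hf s hs, lconv_rlKernel_one hv₁]
  congr 1
  refine intervalIntegral.integral_congr_ae ?_
  filter_upwards [hrep] with u hu hus
  rw [uIoc_of_le hs] at hus
  have hβ : 0 < α - 1 := by linarith
  have e1 := (lConvAt_rlKernel hβ one_pos u).const_mul_left w₀
  have e2 := lconv_rlKernel_lconv_rlKernel hv hβ one_pos (by linarith) u
  rw [hu, velocity, lconv_add_left e1 e2.1, e2.2, lconv_const_mul_left, lconv_rlKernel hβ one_pos,
    sub_add_cancel, rlKernel_one_of_pos hus.1]
  ring

/-- Let `f = a + ∫ v₁` on `[0, ∞)`, where `v₁ = κ + w₀ k_α + v ⊛ k_α` almost everywhere. Then `f` has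
the Caputo derivative `w₀ + ∫ v` of order `α` at every point of `(0, ∞)`. For `α ≤ 1` the function
`v₁` is the almost everywhere derivative of `f`; for `α > 1` it agrees almost everywhere with the
absolutely continuous function `velocity α κ w₀ v`, the classical derivative of `f`. -/
theorem hasCaputoDeriv_of_antideriv {α : ℝ} {v₁ : ℝ → ℝ} (hα : 0 < α) (hα2 : α ≤ 2)
    (hv : CausalLI v) (hv₁ : CausalLI v₁) (hf : ∀ s, 0 ≤ s → f s = a + (v₁ ⊛ rlKernel 1) s)
    (hrep : v₁ =ᵐ[volume] fun s => κ * rlKernel 1 s + w₀ * rlKernel α s + (v ⊛ rlKernel α) s)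
    (hκ : α ≤ 1 → κ = 0) (ht : 0 < t) : HasCaputoDeriv α f t (w₀ + (v ⊛ rlKernel 1) t) := by
  rcases le_or_gt α 1 with h1 | h1
  · have hn := ceil_eq_one_of_le_one hα h1
    obtain ⟨c1, c2, c3⟩ := fracInt_deriv (D := f) (a := a) (w₀ := w₀) hα h1 hv (fun s hs => by
      rw [hf s hs.le, lconv_congr_ae_left _ hrep, hκ h1]
      simp only [zero_mul, zero_add]) ht
    have hAC : AbsolutelyContinuousOnInterval f 0 t :=
      (absolutelyContinuous_lconv_rlKernel_one hv₁ a t).congr fun s hs => by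
        rw [uIcc_of_le ht.le] at hs
        exact (hf s hs.1).symm
    unfold HasCaputoDeriv caputoDeriv
    rw [hn]
    simp only [Nat.cast_one, iteratedDeriv_one, tsub_self, iteratedDeriv_zero,
      iteratedDerivWithin_zero, CharP.cast_eq_zero]
    refine ⟨?_, hAC, c1, c2, c3⟩
    refine contDiffOn_zero.2 ?_
    simpa [uIcc_of_le ht.le] using hAC.continuousOn
  · have hn := ceil_eq_two_of_one_lt h1 hα2
    have hβ : 0 < α - 1 := by linarith
    have hqcont := continuous_velocity (κ := κ) (w₀ := w₀) h1 hv
    set F : ℝ → ℝ := fun s => a + ∫ u in (0 : ℝ)..s, velocity α κ w₀ v u with hF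
    have hFf (s : ℝ) (hs : 0 ≤ s) : f s = F s := eq_integral_velocity h1 hv hv₁ hf hrep hs
    have hFd (s : ℝ) : HasDerivAt F (velocity α κ w₀ v s) s :=
      hasDerivAt_integral_velocity h1 hv a s
    have hFC : ContDiff ℝ 1 F :=
      contDiff_one_iff_deriv.2 ⟨fun s => (hFd s).differentiableAt, by
        rw [funext fun s => (hFd s).deriv]; exact hqcont⟩
    have hderiv (s : ℝ) (hs : 0 < s) : deriv f s = velocity α κ w₀ v s := by
      refine ((hFd s).congr_of_eventuallyEq ?_).deriv
      filter_upwards [Ioi_mem_nhds hs] with u hu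
      exact hFf u (le_of_lt hu)
    obtain ⟨c1, c2, c3⟩ := fracInt_deriv (D := deriv f) (a := κ) (w₀ := w₀) hβ (by linarith) hv
      hderiv ht
    have e : 1 - (α - 1) = 2 - α := by ring
    rw [e] at c1 c3
    unfold HasCaputoDeriv caputoDeriv
    rw [hn]
    have e2 : iteratedDeriv 2 f = deriv (deriv f) := by
      rw [iteratedDeriv_succ, iteratedDeriv_one]
    rw [e2]
    have hdw : EqOn (velocity α κ w₀ v)
        (iteratedDerivWithin 1 f (Icc 0 t)) (uIcc 0 t) := by
      intro s hs
      rw [uIcc_of_le ht.le] at hs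
      rw [iteratedDerivWithin_one]
      refine (((hFd s).hasDerivWithinAt.congr (fun u hu => hFf u hu.1)
        (hFf s hs.1)).derivWithin ((uniqueDiffOn_Icc ht) s hs)).symm
    refine ⟨?_, ?_, c1, fun h => ?_, c3⟩
    · exact (hFC.contDiffOn (s := Icc 0 t)).congr fun s hs => hFf s hs.1
    · exact (absolutelyContinuous_lconv_rlKernel_one
        (causalLI_velocity_source h1 hv) κ t).congr hdw
    · rw [show 2 - 1 = 1 from rfl, iteratedDeriv_one]
      push_cast at h
      exact c2 (by linarith)

/-- For orders above `1` the constant `κ` is the initial velocity. -/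
theorem hasDerivWithinAt_of_antideriv {α : ℝ} {v₁ : ℝ → ℝ} (hα : 1 < α)
    (hv : CausalLI v) (hv₁ : CausalLI v₁) (hf : ∀ s, 0 ≤ s → f s = a + (v₁ ⊛ rlKernel 1) s)
    (hrep : v₁ =ᵐ[volume] fun s => κ * rlKernel 1 s + w₀ * rlKernel α s + (v ⊛ rlKernel α) s) :
    HasDerivWithinAt f κ (Ici 0) 0 := by
  have h := (hasDerivAt_integral_velocity (κ := κ) (w₀ := w₀) hα hv a 0).hasDerivWithinAt
    (s := Ici 0)
  have h0 : velocity α κ w₀ v 0 = κ := by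
    rw [velocity, lconv_of_nonpos (causalLI_velocity_source hα hv).causal
      (fun t ht => rlKernel_of_nonpos 1 ht) le_rfl, add_zero]
  rw [h0] at h
  exact h.congr (fun s hs => eq_integral_velocity hα hv hv₁ hf hrep hs)
    (eq_integral_velocity hα hv hv₁ hf hrep le_rfl)

end criterion

/-! ### The history as a source -/

/-- The delayed history `φ (· - τ)` on `(0, τ)`, extended by `0`. -/
noncomputable def history (τ : ℝ) (φ : ℝ → ℝ) (s : ℝ) : ℝ :=
  if 0 < s ∧ s < τ then φ (s - τ) else 0

/-- The increment `φ (s - τ) - φ (-τ)` of the delayed history, extended to a continuous function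
which is constant outside `[0, τ]`. -/
def historyIncr (τ : ℝ) (φ : ℝ → ℝ) (s : ℝ) : ℝ := φ (min (max s 0) τ - τ) - φ (-τ)

section history

variable {τ : ℝ} {φ : ℝ → ℝ}

theorem historyIncr_of_nonpos (hτ : 0 < τ) {s : ℝ} (hs : s ≤ 0) : historyIncr τ φ s = 0 := by
  simp [historyIncr, max_eq_right hs, hτ.le]

theorem historyIncr_of_mem {s : ℝ} (h0 : 0 ≤ s) (hs : s ≤ τ) :
    historyIncr τ φ s = φ (s - τ) - φ (-τ) := by
  simp [historyIncr, max_eq_left h0, hs]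

theorem historyIncr_of_ge (hτ : 0 < τ) {s : ℝ} (hs : τ ≤ s) :
    historyIncr τ φ s = φ 0 - φ (-τ) := by
  simp [historyIncr, max_eq_left (hτ.le.trans hs), hs]

theorem continuous_historyIncr (hτ : 0 < τ) (hφ : ContinuousOn φ (Icc (-τ) 0)) :
    Continuous (historyIncr τ φ) := by
  have h1 : Continuous fun s : ℝ => min (max s 0) τ - τ := by fun_prop
  refine (hφ.comp_continuous h1 fun s => ⟨?_, ?_⟩).sub continuous_const
  · have := le_min (le_max_right s 0) hτ.le
    linarith
  · linarith [min_le_right (max s 0) τ]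

/-- The history is a continuous function up to its jumps at `0` and at `τ`. -/
theorem history_eq (hτ : 0 < τ) {s : ℝ} (hs : s ≠ τ) :
    history τ φ s = φ (-τ) * rlKernel 1 s + (-φ 0) * rlKernel 1 (s - τ) + historyIncr τ φ s := by
  rcases le_or_gt s 0 with h0 | h0
  · rw [history, if_neg (fun h => h0.not_gt h.1), rlKernel_of_nonpos 1 h0,
      rlKernel_of_nonpos 1 (by linarith), historyIncr_of_nonpos hτ h0]
    ring
  · rcases lt_or_gt_of_ne hs with h1 | h1
    · rw [history, if_pos ⟨h0, h1⟩, rlKernel_one_of_pos h0, rlKernel_of_nonpos 1 (by linarith),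
        historyIncr_of_mem h0.le h1.le]
      ring
    · rw [history, if_neg (fun h => h1.not_gt h.2), rlKernel_one_of_pos h0,
        rlKernel_one_of_pos (by linarith), historyIncr_of_ge hτ h1.le]
      ring

theorem history_ae_eq (hτ : 0 < τ) : history τ φ =ᵐ[volume] fun s =>
    φ (-τ) * rlKernel 1 s + (-φ 0) * rlKernel 1 (s - τ) + historyIncr τ φ s := by
  filter_upwards [Measure.ae_ne volume τ] with s hs
  exact history_eq hτ hs

theorem causalLI_historyIncr (hτ : 0 < τ) (hφ : ContinuousOn φ (Icc (-τ) 0)) :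
    CausalLI (historyIncr τ φ) :=
  .of_continuous (fun _ ht => historyIncr_of_nonpos hτ ht) (continuous_historyIncr hτ hφ)

theorem history_of_nonpos {s : ℝ} (hs : s ≤ 0) : history τ φ s = 0 :=
  if_neg fun h => hs.not_gt h.1

theorem causalLI_history (hτ : 0 < τ) (hφ : ContinuousOn φ (Icc (-τ) 0)) :
    CausalLI (history τ φ) := by
  have h1 := causalLI_rlKernel one_pos
  exact (((h1.const_mul (φ (-τ))).add ((h1.shift hτ.le).const_mul (-φ 0))).add
    (causalLI_historyIncr hτ hφ)).congr_ae (fun s hs => history_of_nonpos hs)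
    (history_ae_eq hτ).symm

theorem history_bounded (hφ : ContinuousOn φ (Icc (-τ) 0)) :
    ∃ C, ∀ s, |history τ φ s| ≤ C := by
  obtain ⟨C, hC⟩ := isCompact_Icc.exists_bound_of_continuousOn hφ
  refine ⟨max C 0, fun s => ?_⟩
  rw [history]
  split_ifs with h
  · exact (hC _ ⟨by linarith [h.1], by linarith [h.2]⟩).trans (le_max_left _ _)
  · simp

theorem continuousOn_of_absolutelyContinuous (hτ : 0 < τ)
    (hφ : AbsolutelyContinuousOnInterval φ (-τ) 0) : ContinuousOn φ (Icc (-τ) 0) := by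
  have h := hφ.continuousOn
  rwa [uIcc_of_le (by linarith)] at h

/-- The derivative of the delayed history, on `(0, τ)`. -/
noncomputable def historyDeriv (τ : ℝ) (φ : ℝ → ℝ) : ℝ → ℝ := history τ (deriv φ)

theorem causalLI_historyDeriv (hτ : 0 < τ) (hφ : AbsolutelyContinuousOnInterval φ (-τ) 0) :
    CausalLI (historyDeriv τ φ) := by
  refine ⟨fun t ht => history_of_nonpos ht, Integrable.locallyIntegrable ?_⟩
  have h := (hφ.intervalIntegrable_deriv).comp_sub_right τ
  rw [neg_add_cancel, zero_add, intervalIntegrable_iff_integrableOn_Ioo_of_le hτ.le,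
    ← integrable_indicator_iff measurableSet_Ioo] at h
  refine h.congr (Eventually.of_forall fun s => ?_)
  simp [indicator_apply, historyDeriv, history]

/-- The fundamental theorem of calculus for the absolutely continuous history. -/
theorem lconv_historyDeriv (hτ : 0 < τ) (hφ : AbsolutelyContinuousOnInterval φ (-τ) 0) :
    historyDeriv τ φ ⊛ rlKernel 1 = historyIncr τ φ := by
  have hF := causalLI_historyDeriv hτ hφ
  have key (x : ℝ) (h0 : 0 ≤ x) (hx : x ≤ τ) :
      (∫ s in (0 : ℝ)..x, historyDeriv τ φ s) = φ (x - τ) - φ (-τ) := by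
    have h1 : (∫ s in (0 : ℝ)..x, historyDeriv τ φ s) = ∫ s in (0 : ℝ)..x, deriv φ (s - τ) := by
      rw [intervalIntegral.integral_of_le h0, intervalIntegral.integral_of_le h0,
        integral_Ioc_eq_integral_Ioo, integral_Ioc_eq_integral_Ioo]
      refine setIntegral_congr_fun measurableSet_Ioo fun s hs => ?_
      exact if_pos ⟨hs.1, hs.2.trans_le hx⟩
    rw [h1, intervalIntegral.integral_comp_sub_right, zero_sub]
    refine (hφ.mono ?_).integral_deriv_eq_sub
    rw [uIcc_of_le (by linarith), uIcc_of_le (by linarith)]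
    exact Icc_subset_Icc le_rfl (by linarith)
  funext x
  rw [lconv_rlKernel_one hF]
  rcases le_total x 0 with h0 | h0
  · rw [← lconv_rlKernel_one hF, lconv_of_nonpos hF.causal
      (fun t ht => rlKernel_of_nonpos 1 ht) h0, historyIncr_of_nonpos hτ h0]
  · rcases le_total x τ with hx | hx
    · rw [key x h0 hx, historyIncr_of_mem h0 hx]
    · rw [← intervalIntegral.integral_add_adjacent_intervals (hF.intervalIntegrable 0 τ)
        (hF.intervalIntegrable τ x), key τ hτ.le le_rfl, historyIncr_of_ge hτ hx, sub_self,
        intervalIntegral.integral_zero_ae, add_zero]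
      refine Eventually.of_forall fun s hs => ?_
      rw [uIoc_of_le hx] at hs
      exact if_neg fun h => hs.1.not_gt h.2

variable {α c h : ℝ}

theorem ae_forall_ne_mul (τ : ℝ) : ∀ᵐ s : ℝ, ∀ m : ℕ, s ≠ m * τ :=
  ae_all_iff.2 fun m => Measure.ae_ne volume ((m : ℝ) * τ)

theorem conv_history (hα : 0 < α) (hτ : 0 < τ) (φ : ℝ → ℝ) {t : ℝ} (ht : 0 < t) :
    conv (delayML α τ c h α) (fun s => φ (s - τ) * rho (s - τ)) t =
      (history τ φ ⊛ delayKernel α τ c h α) t := by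
  rw [lconv_eq_intervalIntegral (fun s hs => history_of_nonpos hs)
    (fun s hs => delayKernel_of_nonpos hτ α hs) ht.le, conv, intervalIntegral.integral_of_le ht.le,
    intervalIntegral.integral_of_le ht.le, integral_Ioc_eq_integral_Ioo,
    integral_Ioc_eq_integral_Ioo]
  refine setIntegral_congr_ae measurableSet_Ioo ?_
  have hae := (quasiMeasurePreserving_sub_left_of_right_invariant (volume : Measure ℝ) t).ae
    (ae_forall_ne_mul τ)
  filter_upwards [hae] with s hs hst
  rw [delayML_eq_delayKernel hα hτ hα (by linarith [hst.2]) (Or.inr hs), history, rho]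
  by_cases h1 : s < τ
  · rw [if_pos (by linarith), if_pos ⟨hst.1, h1⟩]
    ring
  · rw [if_neg (by linarith), if_neg fun h => h1 h.2]
    ring

/-- The convolution of the history with the resolvent kernel, the jumps of the history being
integrated explicitly. -/
theorem lconv_history_delayKernel (hα : 0 < α) (hτ : 0 < τ) (hφ : ContinuousOn φ (Icc (-τ) 0))
    (x : ℝ) : (history τ φ ⊛ delayKernel α τ c h α) x =
      φ (-τ) * delayKernel α τ c h (α + 1) x - φ 0 * delayKernel α τ c h (α + 1) (x - τ) +
        (historyIncr τ φ ⊛ delayKernel α τ c h α) x := by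
  obtain ⟨hK1, hK2⟩ := lconv_delayKernel (c := c) (h := h) hα hτ hα one_pos
  have e1 := (hK1 x).symm.const_mul_left (φ (-τ))
  have e2 := (hK1 (x - τ)).symm.shift_left.const_mul_left (-φ 0)
  have e3 : LConvAt (historyIncr τ φ) (delayKernel α τ c h α) x :=
    ((causalLI_delayKernel hα hτ hα).lConvAt_of_bounded (causalLI_historyIncr hτ hφ)
      (CausalLI.bounded_of_continuous (fun _ ht => historyIncr_of_nonpos hτ ht)
        (continuous_historyIncr hτ hφ)) x).symm
  rw [lconv_congr_ae_left _ (history_ae_eq hτ), lconv_add_left (e1.add_left e2) e3,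
    lconv_add_left e1 e2, lconv_const_mul_left, lconv_const_mul_left, lconv_shift_left,
    lconv_comm (rlKernel 1), hK2]
  ring

end history

/-! ### The coefficient functions of the Caputo problem -/

section caputo

variable {α τ c h g κ : ℝ} {φ : ℝ → ℝ}

/-- The initial velocity, which is only prescribed for orders above `1`. -/
noncomputable def velocityDatum (α κ : ℝ) : ℝ := if 1 < α then κ else 0

/-- The almost everywhere derivative of `deltaCaputo` on `(0, ∞)`. It solves the same delay equation
with the derivative of the history as its source. -/
noncomputable def deltaCaputoDeriv (α τ c h g : ℝ) (φ : ℝ → ℝ) (κ : ℝ) : ℝ → ℝ :=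
  delaySol α τ c h (fun s => h * historyDeriv τ φ s) (g + c * φ 0 + h * φ (-τ)) α
    (velocityDatum α κ) 1

theorem causalLI_deltaCaputoDeriv (hα : 0 < α) (hτ : 0 < τ)
    (hφ : AbsolutelyContinuousOnInterval φ (-τ) 0) :
    CausalLI (deltaCaputoDeriv α τ c h g φ κ) :=
  causalLI_delaySol hα hτ hα one_pos ((causalLI_historyDeriv hτ hφ).const_mul h)

theorem lconv_deltaCaputoDeriv (hα : 0 < α) (hτ : 0 < τ)
    (hφ : AbsolutelyContinuousOnInterval φ (-τ) 0) (x : ℝ) :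
    (deltaCaputoDeriv α τ c h g φ κ ⊛ rlKernel 1) x =
      h * (historyIncr τ φ ⊛ delayKernel α τ c h α) x
        + (g + c * φ 0 + h * φ (-τ)) * delayKernel α τ c h (α + 1) x
        + velocityDatum α κ * delayKernel α τ c h 2 x := by
  have hF := causalLI_historyDeriv hτ hφ
  have hK := causalLI_delayKernel (c := c) (h := h) hα hτ hα
  have h1 := causalLI_rlKernel one_pos
  have hb : LConvAt (fun t => |delayKernel α τ c h α t|)
      ((fun t => |historyDeriv τ φ t|) ⊛ (fun t => |rlKernel 1 t|)) x := by
    rw [abs_rlKernel one_pos]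
    refine hK.abs.lConvAt_of_bounded (hF.abs.lconv h1) (CausalLI.bounded_of_continuous
      (hF.abs.lconv h1).causal (continuous_lconv_rlKernel_one hF.abs)) x
  have e0 : ((historyDeriv τ φ ⊛ delayKernel α τ c h α) ⊛ rlKernel 1) x =
      (historyIncr τ φ ⊛ delayKernel α τ c h α) x := by
    rw [lconv_comm (historyDeriv τ φ), hK.lconv_assoc hF h1 hb, lconv_historyDeriv hτ hφ,
      lconv_comm]
  have e0' : LConvAt (historyDeriv τ φ ⊛ delayKernel α τ c h α) (rlKernel 1) x := by
    rw [lconv_comm (historyDeriv τ φ)]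
    exact hK.lConvAt_lconv_left hF h1 hb
  have e1 := e0'.const_mul_left h
  obtain ⟨hA1, hA2⟩ := lconv_delayKernel (c := c) (h := h) hα hτ hα one_pos
  obtain ⟨hB1, hB2⟩ := lconv_delayKernel (c := c) (h := h) hα hτ one_pos one_pos
  have e2 := (hA1 x).const_mul_left (g + c * φ 0 + h * φ (-τ))
  have e3 := (hB1 x).const_mul_left (velocityDatum α κ)
  have hdef : deltaCaputoDeriv α τ c h g φ κ = fun t =>
      h * (historyDeriv τ φ ⊛ delayKernel α τ c h α) t
        + (g + c * φ 0 + h * φ (-τ)) * delayKernel α τ c h α t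
        + velocityDatum α κ * delayKernel α τ c h 1 t := by
    funext t
    rw [← lconv_const_mul_left]
    rfl
  rw [hdef, lconv_add_left (e1.add_left e2) e3, lconv_add_left e1 e2, lconv_const_mul_left,
    lconv_const_mul_left, lconv_const_mul_left, e0, hA2, hB2, one_add_one_eq_two]

theorem deltaCaputo_eq (hα : 0 < α) (hτ : 0 < τ)
    (hφ : AbsolutelyContinuousOnInterval φ (-τ) 0) {t : ℝ} (ht : 0 ≤ t) :
    deltaCaputo α τ c h g φ κ t =
      φ 0 + (deltaCaputoDeriv α τ c h g φ κ ⊛ rlKernel 1) t := by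
  rcases eq_or_lt_of_le ht with rfl | ht
  · rw [deltaCaputo, if_pos le_rfl, lconv_of_nonpos
      (causalLI_deltaCaputoDeriv hα hτ hφ).causal (fun t ht => rlKernel_of_nonpos 1 ht) le_rfl,
      add_zero]
  · have hφc := continuousOn_of_absolutelyContinuous hτ hφ
    have hK1 := congrFun (delayKernel_eq (c := c) (h := h) hα hτ one_pos) t
    rw [delayOp_apply, rlKernel_one_of_pos ht, add_comm 1 α] at hK1
    rw [lconv_deltaCaputoDeriv hα hτ hφ, deltaCaputo, if_neg ht.not_ge,
      conv_history hα hτ φ ht, lconv_history_delayKernel hα hτ hφc,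
      delayML_eq_delayKernel hα hτ (by linarith) ht (Or.inl (by linarith)),
      delayML_eq_delayKernel hα hτ one_pos ht (Or.inl le_rfl),
      delayML_eq_delayKernel hα hτ two_pos ht (Or.inl one_le_two), hK1, velocityDatum]
    split_ifs <;> ring

/-- The right-hand side of the delay equation is absolutely continuous. -/
theorem deltaCaputo_rhs_eq (hα : 0 < α) (hτ : 0 < τ)
    (hφ : AbsolutelyContinuousOnInterval φ (-τ) 0) {t : ℝ} (ht : 0 < t) :
    g + c * deltaCaputo α τ c h g φ κ t + h * deltaCaputo α τ c h g φ κ (t - τ) =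
      (g + c * φ 0 + h * φ (-τ)) + ((fun s => h * historyDeriv τ φ s +
        delayOp τ c h (deltaCaputoDeriv α τ c h g φ κ) s) ⊛ rlKernel 1) t := by
  have hV := causalLI_deltaCaputoDeriv (c := c) (h := h) (g := g) (κ := κ) hα hτ hφ
  have hF := causalLI_historyDeriv hτ hφ
  have h1 (x : ℝ) := lConvAt_rlKernel_right hV le_rfl x
  have h2 := (lConvAt_rlKernel_right hF le_rfl t).const_mul_left h
  rw [lconv_add_left h2 ((h1 t).delayOp (h1 _)), lconv_delayOp (h1 t) (h1 _), delayOp_apply,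
    lconv_const_mul_left, lconv_historyDeriv hτ hφ, deltaCaputo_eq hα hτ hφ ht.le]
  rcases le_total τ t with hτt | hτt
  · rw [deltaCaputo_eq hα hτ hφ (sub_nonneg.2 hτt), historyIncr_of_ge hτ hτt]
    ring
  · rw [historyIncr_of_mem ht.le hτt, deltaCaputo, if_pos (sub_nonpos.2 hτt),
      lconv_of_nonpos hV.causal (fun t ht => rlKernel_of_nonpos 1 ht) (sub_nonpos.2 hτt)]
    ring

theorem deltaCaputoDeriv_ae_eq (hα : 0 < α) (hτ : 0 < τ)
    (hφ : AbsolutelyContinuousOnInterval φ (-τ) 0) :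
    deltaCaputoDeriv α τ c h g φ κ =ᵐ[volume] fun s => velocityDatum α κ * rlKernel 1 s
      + (g + c * φ 0 + h * φ (-τ)) * rlKernel α s + ((fun s => h * historyDeriv τ φ s +
        delayOp τ c h (deltaCaputoDeriv α τ c h g φ κ) s) ⊛ rlKernel α) s := by
  refine (delaySol_ae_eq hα hτ hα one_pos
    ((causalLI_historyDeriv hτ hφ).const_mul h)).trans (Eventually.of_forall fun s => ?_)
  simp only
  rw [add_comm (velocityDatum α κ * rlKernel 1 s)]
  rfl

theorem hasCaputoDeriv_deltaCaputo (hα : 0 < α) (hα2 : α ≤ 2) (hτ : 0 < τ)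
    (hφ : AbsolutelyContinuousOnInterval φ (-τ) 0) {t : ℝ} (ht : 0 < t) :
    HasCaputoDeriv α (deltaCaputo α τ c h g φ κ) t
      (g + c * deltaCaputo α τ c h g φ κ t + h * deltaCaputo α τ c h g φ κ (t - τ)) := by
  have hV := causalLI_deltaCaputoDeriv (c := c) (h := h) (g := g) (κ := κ) hα hτ hφ
  have hF := causalLI_historyDeriv hτ hφ
  rw [deltaCaputo_rhs_eq hα hτ hφ ht]
  exact hasCaputoDeriv_of_antideriv hα hα2 ((hF.const_mul h).add (hV.delayOp hτ.le)) hV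
    (fun s hs => deltaCaputo_eq hα hτ hφ hs) (deltaCaputoDeriv_ae_eq hα hτ hφ)
    (fun h => if_neg h.not_gt) ht

theorem hasDerivWithinAt_deltaCaputo (hα : 1 < α) (hτ : 0 < τ)
    (hφ : AbsolutelyContinuousOnInterval φ (-τ) 0) :
    HasDerivWithinAt (deltaCaputo α τ c h g φ κ) κ (Ici 0) 0 := by
  have hα0 : 0 < α := by linarith
  have hV := causalLI_deltaCaputoDeriv (c := c) (h := h) (g := g) (κ := κ) hα0 hτ hφ
  have hF := causalLI_historyDeriv hτ hφ
  have := hasDerivWithinAt_of_antideriv hα ((hF.const_mul h).add (hV.delayOp hτ.le)) hV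
    (fun s hs => deltaCaputo_eq hα0 hτ hφ hs) (deltaCaputoDeriv_ae_eq hα0 hτ hφ)
  rwa [velocityDatum, if_pos hα] at this

end caputo

/-! ### The coefficient functions of the Riemann-Liouville problem -/

theorem isOpen_ne_mul {τ : ℝ} (hτ : 0 < τ) : IsOpen {t : ℝ | ∀ m : ℕ, t ≠ m * τ} := by
  have h := (Nat.isClosedEmbedding_coe_real.isClosed_range.isOpen_compl).preimage
    (continuous_id.div_const τ)
  convert h using 1
  ext t
  simp only [id_eq, mem_ofPred_eq, mem_preimage, mem_compl_iff, mem_range, not_exists]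
  refine forall_congr' fun m => ?_
  rw [eq_div_iff hτ.ne', eq_comm]

theorem contDiffOn_succ_of_hasDerivAt {U : Set ℝ} (hU : IsOpen U) {f f' : ℝ → ℝ} {n : ℕ}
    (hf : ∀ t ∈ U, HasDerivAt f (f' t) t) (hf' : ContDiffOn ℝ n f' U) :
    ContDiffOn ℝ (n + 1 : ℕ) f U := by
  push_cast
  rw [contDiffOn_succ_iff_deriv_of_isOpen hU]
  refine ⟨fun t ht => (hf t ht).differentiableAt.differentiableWithinAt, fun h => ?_,
    hf'.congr fun t ht => (hf t ht).deriv⟩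
  exact absurd h (by simp)

section rl

variable {α τ c h g β κ : ℝ} {φ : ℝ → ℝ}

/-- The bounded source `h φ(· - τ) + g` of the delay equation. -/
noncomputable def rlSource (τ h g : ℝ) (φ : ℝ → ℝ) (s : ℝ) : ℝ :=
  h * history τ φ s + g * rlKernel 1 s

/-- The order of the kernel which carries the second initial datum. For `α ≤ 1` this datum is `0`
and the order is irrelevant. -/
noncomputable def secondOrder (α : ℝ) : ℝ := if 1 < α then α - 1 else 1

theorem secondOrder_pos (α : ℝ) : 0 < secondOrder α := by
  rw [secondOrder]
  split_ifs with h
  · linarith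
  · exact one_pos

/-- The causal part of `deltaRL`. -/
noncomputable def rlSol (α τ c h g : ℝ) (φ : ℝ → ℝ) (β κ : ℝ) : ℝ → ℝ :=
  delaySol α τ c h (rlSource τ h g φ) β α (velocityDatum α κ) (secondOrder α)

/-- The right-hand side of the delay equation for `rlSol`. -/
noncomputable def rlRhs (α τ c h g : ℝ) (φ : ℝ → ℝ) (β κ t : ℝ) : ℝ :=
  rlSource τ h g φ t + delayOp τ c h (rlSol α τ c h g φ β κ) t

theorem causalLI_rlSource (hτ : 0 < τ) (hφ : ContinuousOn φ (Icc (-τ) 0)) :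
    CausalLI (rlSource τ h g φ) :=
  ((causalLI_history hτ hφ).const_mul h).add ((causalLI_rlKernel one_pos).const_mul g)

theorem rlSource_bounded (hφ : ContinuousOn φ (Icc (-τ) 0)) (T : ℝ) :
    ∃ C, ∀ t ≤ T, |rlSource τ h g φ t| ≤ C := by
  obtain ⟨C, hC⟩ := history_bounded hφ
  refine ⟨|h| * C + |g| * rlKernel 1 T, fun t ht => ?_⟩
  rw [rlSource]
  refine (abs_add_le _ _).trans ?_
  rw [abs_mul, abs_mul, abs_of_nonneg (rlKernel_nonneg one_pos t)]
  have := hC t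
  have := monotone_rlKernel le_rfl ht
  gcongr

theorem causalLI_rlSol (hα : 0 < α) (hτ : 0 < τ) (hφ : ContinuousOn φ (Icc (-τ) 0)) :
    CausalLI (rlSol α τ c h g φ β κ) :=
  causalLI_delaySol hα hτ hα (secondOrder_pos α) (causalLI_rlSource hτ hφ)

theorem causalLI_rlRhs (hα : 0 < α) (hτ : 0 < τ) (hφ : ContinuousOn φ (Icc (-τ) 0)) :
    CausalLI (rlRhs α τ c h g φ β κ) :=
  (causalLI_rlSource hτ hφ).add ((causalLI_rlSol hα hτ hφ).delayOp hτ.le)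

theorem rlSol_eq (hα : 0 < α) (hτ : 0 < τ) (hφ : ContinuousOn φ (Icc (-τ) 0)) (x : ℝ) :
    rlSol α τ c h g φ β κ x = β * rlKernel α x + velocityDatum α κ * rlKernel (secondOrder α) x
      + (rlRhs α τ c h g φ β κ ⊛ rlKernel α) x :=
  delaySol_eq hα hτ hα (secondOrder_pos α) (causalLI_rlSource hτ hφ) (rlSource_bounded hφ) x

theorem lconv_rlSource (hα : 0 < α) (hτ : 0 < τ) (hφ : ContinuousOn φ (Icc (-τ) 0)) (x : ℝ) :
    (rlSource τ h g φ ⊛ delayKernel α τ c h α) x =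
      h * (history τ φ ⊛ delayKernel α τ c h α) x + g * delayKernel α τ c h (α + 1) x := by
  obtain ⟨hK1, hK2⟩ := lconv_delayKernel (c := c) (h := h) hα hτ hα one_pos
  obtain ⟨C, hC⟩ := history_bounded hφ
  have e1 : LConvAt (history τ φ) (delayKernel α τ c h α) x :=
    ((causalLI_delayKernel hα hτ hα).lConvAt_of_bounded (causalLI_history hτ hφ)
      (fun T => ⟨C, fun t _ => hC t⟩) x).symm
  refine (lconv_add_left (e1.const_mul_left h) ((hK1 x).symm.const_mul_left g)).trans ?_
  rw [lconv_const_mul_left, lconv_const_mul_left, lconv_comm (rlKernel 1), hK2]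

theorem continuousAt_history (hτ : 0 < τ) (hφ : ContinuousOn φ (Icc (-τ) 0)) {t : ℝ}
    (h0 : t ≠ 0) (h1 : t ≠ τ) : ContinuousAt (history τ φ) t := by
  have hk : ContinuousAt (fun s => rlKernel 1 (s - τ)) t :=
    ContinuousAt.comp (f := fun s => s - τ) (continuousAt_rlKernel 1 (sub_ne_zero.2 h1))
      (continuous_id.sub continuous_const).continuousAt
  refine (((continuousAt_const.mul (continuousAt_rlKernel 1 h0)).add
    (continuousAt_const.mul hk)).add (continuous_historyIncr hτ hφ).continuousAt).congr
    (f := fun s => φ (-τ) * rlKernel 1 s + (-φ 0) * rlKernel 1 (s - τ) + historyIncr τ φ s) ?_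
  filter_upwards [isOpen_ne.mem_nhds h1] with s hs
  exact (history_eq hτ hs).symm

theorem continuousAt_rlSol (hα : 0 < α) (hτ : 0 < τ) (hφ : ContinuousOn φ (Icc (-τ) 0)) {t : ℝ}
    (ht : ∀ m : ℕ, t ≠ m * τ) : ContinuousAt (rlSol α τ c h g φ β κ) t := by
  have hK1 : Continuous (delayKernel α τ c h (α + 1)) :=
    continuous_delayKernel hα hτ (by linarith)
  have hc : Continuous (rlSource τ h g φ ⊛ delayKernel α τ c h α) := by
    rw [funext (lconv_rlSource hα hτ hφ)]
    simp only [lconv_history_delayKernel hα hτ hφ]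
    have h2 : Continuous (historyIncr τ φ ⊛ delayKernel α τ c h α) := by
      rw [lconv_comm]
      exact (causalLI_delayKernel hα hτ hα).continuous_lconv
        (fun _ ht => historyIncr_of_nonpos hτ ht) (continuous_historyIncr hτ hφ)
    fun_prop
  exact (hc.continuousAt.add (continuousAt_const.mul (continuousAt_delayKernel hα hτ hα ht))).add
    (continuousAt_const.mul (continuousAt_delayKernel hα hτ (secondOrder_pos α) ht))

theorem continuousAt_rlRhs (hα : 0 < α) (hτ : 0 < τ) (hφ : ContinuousOn φ (Icc (-τ) 0)) {t : ℝ}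
    (ht : ∀ m : ℕ, t ≠ m * τ) : ContinuousAt (rlRhs α τ c h g φ β κ) t := by
  have h0 : t ≠ 0 := by simpa using ht 0
  have h1 : t ≠ τ := by simpa using ht 1
  exact ((continuousAt_const.mul (continuousAt_history hτ hφ h0 h1)).add
    (continuousAt_const.mul (continuousAt_rlKernel 1 h0))).add
    (continuousAt_delayOp (fun s hs => continuousAt_rlSol hα hτ hφ hs) ht)

/-- The orders `1` and `2` are the only ones in `(0, 2]` for which the pointwise values at the
multiples of the delay matter, and for them all kernels involved have order at least `1`. -/
theorem deltaRL_eq (hα : 0 < α) (hτ : 0 < τ) (hφ : ContinuousOn φ (Icc (-τ) 0)) {t : ℝ}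
    (ht : 0 < t) (ht' : (α = 1 ∨ α = 2) ∨ ∀ m : ℕ, t ≠ m * τ) :
    deltaRL α τ c h g φ β κ t = rlSol α τ c h g φ β κ t := by
  have hK (b : ℝ) (hb : 0 < b) (hb1 : α = 1 ∨ α = 2 → 1 ≤ b) :
      delayML α τ c h b t = delayKernel α τ c h b t :=
    delayML_eq_delayKernel hα hτ hb ht (ht'.imp_left hb1)
  have hα1 : α = 1 ∨ α = 2 → 1 ≤ α := by
    rintro (rfl | rfl) <;> norm_num
  rw [deltaRL, if_neg ht.not_ge, conv_history hα hτ φ ht, hK α hα hα1,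
    hK (α + 1) (by linarith) fun _ => by linarith, rlSol, delaySol, lconv_rlSource hα hτ hφ,
    velocityDatum, secondOrder]
  split_ifs with h1
  · rw [hK (α - 1) (by linarith)]
    rintro (rfl | rfl)
    · exact absurd h1 (lt_irrefl _)
    · norm_num
  · ring

theorem deltaRL_ae_eq (hα : 0 < α) (hτ : 0 < τ) (hφ : ContinuousOn φ (Icc (-τ) 0)) :
    ∀ᵐ s, 0 < s → deltaRL α τ c h g φ β κ s = rlSol α τ c h g φ β κ s := by
  filter_upwards [ae_forall_ne_mul τ] with s hs hs0
  exact deltaRL_eq hα hτ hφ hs0 (Or.inr hs)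

theorem rlRhs_eq (hα : 0 < α) (hτ : 0 < τ) (hφ : ContinuousOn φ (Icc (-τ) 0)) {t : ℝ}
    (ht : 0 < t) (ht' : ∀ m : ℕ, t ≠ m * τ) :
    rlRhs α τ c h g φ β κ t = g + c * deltaRL α τ c h g φ β κ t
      + h * deltaRL α τ c h g φ β κ (t - τ) := by
  rw [rlRhs, rlSource, delayOp_apply, deltaRL_eq hα hτ hφ ht (Or.inr ht'), rlKernel_one_of_pos ht]
  have h1 : t ≠ τ := by simpa using ht' 1
  rcases lt_or_gt_of_ne h1 with hlt | hgt
  · rw [history, if_pos ⟨ht, hlt⟩, (causalLI_rlSol hα hτ hφ).causal (t - τ) (by linarith), deltaRL,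
      if_pos (by linarith)]
    ring
  · rw [history, if_neg fun h => hgt.not_gt h.2, deltaRL_eq hα hτ hφ (sub_pos.2 hgt)
      (Or.inr fun m hm => ht' (m + 1) (by push_cast; linarith))]
    ring

/-- The fractional integrals of the coefficient function whose total order is at least `1`. -/
theorem fracInt_deltaRL (hα : 0 < α) (hτ : 0 < τ) (hφ : ContinuousOn φ (Icc (-τ) 0)) {γ : ℝ}
    (hγ : 0 < γ ∧ 1 ≤ α + γ ∨ γ = 0 ∧ (α = 1 ∨ α = 2)) {t : ℝ} (ht : 0 < t) :
    FracIntegrable γ (deltaRL α τ c h g φ β κ) t ∧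
      fracInt γ (deltaRL α τ c h g φ β κ) t = β * rlKernel (α + γ) t
        + velocityDatum α κ * rlKernel (secondOrder α + γ) t
        + (rlRhs α τ c h g φ β κ ⊛ rlKernel (α + γ)) t := by
  rcases hγ with ⟨hγ, hαγ⟩ | ⟨rfl, hα'⟩
  · have hb := secondOrder_pos α
    have e1 := (lConvAt_rlKernel hα hγ t).const_mul_left β
    have e2 := (lConvAt_rlKernel hb hγ t).const_mul_left (velocityDatum α κ)
    have e3 := lconv_rlKernel_lconv_rlKernel
      (causalLI_rlRhs (c := c) (h := h) (g := g) (β := β) (κ := κ) hα hτ hφ) hα hγ hαγ t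
    have hsol := causalLI_rlSol (c := c) (h := h) (g := g) (β := β) (κ := κ) hα hτ hφ
    have hae := deltaRL_ae_eq (c := c) (h := h) (g := g) (β := β) (κ := κ) hα hτ hφ
    have heq := funext (rlSol_eq (c := c) (h := h) (g := g) (β := β) (κ := κ) hα hτ hφ)
    constructor
    · refine fracIntegrable_of_lConvAt hγ hsol.causal hae ht ?_
      rw [heq]
      exact (e1.add_left e2).add_left e3.1
    · rw [fracInt_eq_lconv hγ hsol.causal hae ht, heq, lconv_add_left (e1.add_left e2) e3.1,
        lconv_add_left e1 e2, lconv_const_mul_left, lconv_const_mul_left, e3.2,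
        lconv_rlKernel hα hγ, lconv_rlKernel hb hγ]
  · refine ⟨Or.inl rfl, ?_⟩
    rw [fracInt, if_pos rfl, deltaRL_eq hα hτ hφ ht (Or.inl hα'), rlSol_eq hα hτ hφ, add_zero,
      add_zero]

/-- The first integral `β + ∫ w` of the right-hand side `w` of the delay equation. -/
noncomputable def rlPrimitive (α τ c h g : ℝ) (φ : ℝ → ℝ) (β κ t : ℝ) : ℝ :=
  β + (rlRhs α τ c h g φ β κ ⊛ rlKernel 1) t

theorem continuous_rlPrimitive (hα : 0 < α) (hτ : 0 < τ) (hφ : ContinuousOn φ (Icc (-τ) 0)) :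
    Continuous (rlPrimitive α τ c h g φ β κ) :=
  continuous_const.add (continuous_lconv_rlKernel_one (causalLI_rlRhs hα hτ hφ))

theorem rlPrimitive_zero (hα : 0 < α) (hτ : 0 < τ) (hφ : ContinuousOn φ (Icc (-τ) 0)) :
    rlPrimitive α τ c h g φ β κ 0 = β := by
  rw [rlPrimitive, lconv_of_nonpos (causalLI_rlRhs hα hτ hφ).causal
    (fun t ht => rlKernel_of_nonpos 1 ht) le_rfl, add_zero]

theorem hasDerivAt_rlPrimitive (hα : 0 < α) (hτ : 0 < τ) (hφ : ContinuousOn φ (Icc (-τ) 0))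
    {t : ℝ} (ht : ∀ m : ℕ, t ≠ m * τ) :
    HasDerivAt (rlPrimitive α τ c h g φ β κ) (rlRhs α τ c h g φ β κ t) t := by
  have hw := causalLI_rlRhs (c := c) (h := h) (g := g) (β := β) (κ := κ) hα hτ hφ
  have e : rlPrimitive α τ c h g φ β κ =
      fun t => β + ∫ s in (0 : ℝ)..t, rlRhs α τ c h g φ β κ s := by
    funext s
    rw [rlPrimitive, lconv_rlKernel_one hw]
  rw [e]
  exact (intervalIntegral.integral_hasDerivAt_right (hw.intervalIntegrable 0 t)
    ⟨univ, univ_mem, by simpa using hw.measurable⟩ (continuousAt_rlRhs hα hτ hφ ht)).const_add β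

theorem contDiffOn_rlPrimitive (hα : 0 < α) (hτ : 0 < τ) (hφ : ContinuousOn φ (Icc (-τ) 0)) :
    ContDiffOn ℝ (1 : ℕ) (rlPrimitive α τ c h g φ β κ) {t | ∀ m : ℕ, t ≠ m * τ} :=
  contDiffOn_succ_of_hasDerivAt (n := 0) (isOpen_ne_mul hτ)
    (fun _ ht => hasDerivAt_rlPrimitive hα hτ hφ ht)
    (contDiffOn_zero.2 fun _ ht => (continuousAt_rlRhs hα hτ hφ ht).continuousWithinAt)

/-- The double integral of the right-hand side, with the term `β t`, as a single integral of the
continuous function `rlPrimitive`. -/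
theorem lconv_two_rlRhs (hα : 0 < α) (hτ : 0 < τ) (hφ : ContinuousOn φ (Icc (-τ) 0)) {t : ℝ}
    (ht : 0 < t) : β * rlKernel 2 t + (rlRhs α τ c h g φ β κ ⊛ rlKernel 2) t =
      ∫ s in (0 : ℝ)..t, rlPrimitive α τ c h g φ β κ s := by
  have hw := causalLI_rlRhs (c := c) (h := h) (g := g) (β := β) (κ := κ) hα hτ hφ
  have hc := continuous_lconv_rlKernel_one hw
  have h2 := (lconv_rlKernel_lconv_rlKernel hw one_pos one_pos (by norm_num) t).2
  rw [one_add_one_eq_two] at h2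
  simp only [rlPrimitive]
  rw [← h2, lconv_rlKernel_one (hw.lconv (causalLI_rlKernel one_pos)), rlKernel_two_of_pos ht,
    intervalIntegral.integral_add (intervalIntegrable_const) (hc.intervalIntegrable 0 t),
    intervalIntegral.integral_const, sub_zero, smul_eq_mul, mul_comm]

theorem hasDerivAt_integral_rlPrimitive (hα : 0 < α) (hτ : 0 < τ)
    (hφ : ContinuousOn φ (Icc (-τ) 0)) (a t : ℝ) :
    HasDerivAt (fun t => a + ∫ s in (0 : ℝ)..t, rlPrimitive α τ c h g φ β κ s)
      (rlPrimitive α τ c h g φ β κ t) t :=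
  have hc := continuous_rlPrimitive (c := c) (h := h) (g := g) (β := β) (κ := κ) hα hτ hφ
  (intervalIntegral.integral_hasDerivAt_right (hc.intervalIntegrable 0 t)
    (hc.stronglyMeasurableAtFilter _ _) hc.continuousAt).const_add a

theorem fracInt_deltaRL_of_le_one (hα : 0 < α) (hα1 : α ≤ 1) (hτ : 0 < τ)
    (hφ : ContinuousOn φ (Icc (-τ) 0)) {t : ℝ} (ht : 0 < t) :
    FracIntegrable (1 - α) (deltaRL α τ c h g φ β κ) t ∧
      fracInt (1 - α) (deltaRL α τ c h g φ β κ) t = rlPrimitive α τ c h g φ β κ t := by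
  have hγ : 0 < 1 - α ∧ 1 ≤ α + (1 - α) ∨ 1 - α = 0 ∧ (α = 1 ∨ α = 2) := by
    rcases eq_or_lt_of_le hα1 with rfl | h
    · exact Or.inr ⟨sub_self 1, Or.inl rfl⟩
    · exact Or.inl ⟨by linarith, by linarith⟩
  obtain ⟨h1, h2⟩ := fracInt_deltaRL (c := c) (h := h) (g := g) (β := β) (κ := κ) hα hτ hφ hγ ht
  refine ⟨h1, ?_⟩
  rw [h2, velocityDatum, if_neg hα1.not_gt, add_sub_cancel, rlKernel_one_of_pos ht, rlPrimitive]
  ring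

theorem fracInt_deltaRL_of_one_lt (hα1 : 1 < α) (hα2 : α ≤ 2) (hτ : 0 < τ)
    (hφ : ContinuousOn φ (Icc (-τ) 0)) {t : ℝ} (ht : 0 < t) :
    FracIntegrable (2 - α) (deltaRL α τ c h g φ β κ) t ∧
      fracInt (2 - α) (deltaRL α τ c h g φ β κ) t =
        κ + ∫ s in (0 : ℝ)..t, rlPrimitive α τ c h g φ β κ s := by
  have hα : 0 < α := by linarith
  have hγ : 0 < 2 - α ∧ 1 ≤ α + (2 - α) ∨ 2 - α = 0 ∧ (α = 1 ∨ α = 2) := by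
    rcases eq_or_lt_of_le hα2 with rfl | h
    · exact Or.inr ⟨sub_self 2, Or.inr rfl⟩
    · exact Or.inl ⟨by linarith, by linarith⟩
  obtain ⟨h1, h2⟩ := fracInt_deltaRL (c := c) (h := h) (g := g) (β := β) (κ := κ) hα hτ hφ hγ ht
  refine ⟨h1, ?_⟩
  have e : α - 1 + (2 - α) = 1 := by ring
  rw [h2, ← lconv_two_rlRhs hα hτ hφ ht, velocityDatum, if_pos hα1, secondOrder, if_pos hα1,
    add_sub_cancel, e, rlKernel_one_of_pos ht]
  ring

theorem rlRegular_deltaRL (hα : 0 < α) (hα2 : α ≤ 2) (hτ : 0 < τ)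
    (hφ : ContinuousOn φ (Icc (-τ) 0)) : RLRegular α (deltaRL α τ c h g φ β κ) := by
  have hli : ∀ T : ℝ, 0 < T → IntervalIntegrable (deltaRL α τ c h g φ β κ) volume 0 T := by
    intro T hT
    have h1 := (causalLI_rlSol (c := c) (h := h) (g := g) (β := β) (κ := κ) hα hτ
      hφ).intervalIntegrable 0 T
    rw [intervalIntegrable_iff_integrableOn_Ioc_of_le hT.le] at *
    refine h1.congr ?_
    rw [EventuallyEq, ae_restrict_iff' measurableSet_Ioc]
    filter_upwards [deltaRL_ae_eq (c := c) (h := h) (g := g) (β := β) (κ := κ) hα hτ hφ]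
      with s hs hsT
    exact (hs hsT.1).symm
  unfold RLRegular
  rcases le_or_gt α 1 with h1 | h1
  · rw [ceil_eq_one_of_le_one hα h1, Nat.cast_one]
    refine ⟨hli, fun s hs => (fracInt_deltaRL_of_le_one hα h1 hτ hφ hs).1, contDiffOn_zero.2 ?_⟩
    exact (continuous_rlPrimitive hα hτ hφ).continuousOn.congr
      fun s hs => (fracInt_deltaRL_of_le_one hα h1 hτ hφ hs).2
  · rw [ceil_eq_two_of_one_lt h1 hα2, Nat.cast_ofNat]
    refine ⟨hli, fun s hs => (fracInt_deltaRL_of_one_lt h1 hα2 hτ hφ hs).1, ?_⟩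
    exact (contDiffOn_succ_of_hasDerivAt (n := 0) isOpen_Ioi
      (fun s _ => hasDerivAt_integral_rlPrimitive hα hτ hφ κ s)
      (contDiffOn_zero.2 (continuous_rlPrimitive hα hτ hφ).continuousOn)).congr
      fun s hs => (fracInt_deltaRL_of_one_lt h1 hα2 hτ hφ hs).2

theorem fracInt_deltaRL_eventuallyEq_of_le_one (hα : 0 < α) (hα1 : α ≤ 1) (hτ : 0 < τ)
    (hφ : ContinuousOn φ (Icc (-τ) 0)) {t : ℝ} (ht : 0 < t) :
    fracInt (1 - α) (deltaRL α τ c h g φ β κ) =ᶠ[𝓝 t] rlPrimitive α τ c h g φ β κ := by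
  filter_upwards [Ioi_mem_nhds ht] with s hs
  exact (fracInt_deltaRL_of_le_one hα hα1 hτ hφ hs).2

theorem fracInt_deltaRL_eventuallyEq_of_one_lt (hα1 : 1 < α) (hα2 : α ≤ 2) (hτ : 0 < τ)
    (hφ : ContinuousOn φ (Icc (-τ) 0)) {t : ℝ} (ht : 0 < t) :
    fracInt (2 - α) (deltaRL α τ c h g φ β κ) =ᶠ[𝓝 t]
      fun t => κ + ∫ s in (0 : ℝ)..t, rlPrimitive α τ c h g φ β κ s := by
  filter_upwards [Ioi_mem_nhds ht] with s hs
  exact (fracInt_deltaRL_of_one_lt hα1 hα2 hτ hφ hs).2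

theorem deriv_fracInt_deltaRL (hα1 : 1 < α) (hα2 : α ≤ 2) (hτ : 0 < τ)
    (hφ : ContinuousOn φ (Icc (-τ) 0)) {t : ℝ} (ht : 0 < t) :
    deriv (fracInt (2 - α) (deltaRL α τ c h g φ β κ)) t = rlPrimitive α τ c h g φ β κ t :=
  ((hasDerivAt_integral_rlPrimitive (by linarith) hτ hφ κ t).congr_of_eventuallyEq
    (fracInt_deltaRL_eventuallyEq_of_one_lt hα1 hα2 hτ hφ ht)).deriv

theorem hasRLDeriv_deltaRL (hα : 0 < α) (hα2 : α ≤ 2) (hτ : 0 < τ)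
    (hφ : ContinuousOn φ (Icc (-τ) 0)) {t : ℝ} (ht : 0 < t) (ht' : ∀ m : ℕ, t ≠ m * τ) :
    HasRLDeriv α (deltaRL α τ c h g φ β κ) t (g + c * deltaRL α τ c h g φ β κ t
      + h * deltaRL α τ c h g φ β κ (t - τ)) := by
  rw [← rlRhs_eq hα hτ hφ ht ht']
  have hU := isOpen_ne_mul hτ
  have hP := contDiffOn_rlPrimitive (c := c) (h := h) (g := g) (β := β) (κ := κ) hα hτ hφ
  have hd := hasDerivAt_rlPrimitive (c := c) (h := h) (g := g) (β := β) (κ := κ) hα hτ hφ ht'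
  unfold HasRLDeriv rlDeriv
  rcases le_or_gt α 1 with h1 | h1
  · have he := fracInt_deltaRL_eventuallyEq_of_le_one (c := c) (h := h) (g := g) (β := β) (κ := κ)
      hα h1 hτ hφ ht
    rw [ceil_eq_one_of_le_one hα h1, iteratedDeriv_one]
    simp only [Nat.cast_one]
    exact ⟨(hP.contDiffAt (hU.mem_nhds ht')).congr_of_eventuallyEq he,
      (hd.congr_of_eventuallyEq he).deriv⟩
  · rw [ceil_eq_two_of_one_lt h1 hα2, iteratedDeriv_succ, iteratedDeriv_one]
    simp only [Nat.cast_ofNat]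
    constructor
    · refine ContDiffAt.congr_of_eventuallyEq ?_
        (fracInt_deltaRL_eventuallyEq_of_one_lt h1 hα2 hτ hφ ht)
      exact (contDiffOn_succ_of_hasDerivAt hU
        (fun s _ => hasDerivAt_integral_rlPrimitive hα hτ hφ κ s) hP).contDiffAt (hU.mem_nhds ht')
    · refine (hd.congr_of_eventuallyEq ?_).deriv
      filter_upwards [Ioi_mem_nhds ht] with s hs
      exact deriv_fracInt_deltaRL h1 hα2 hτ hφ hs

theorem tendsto_rlPrimitive (hα : 0 < α) (hτ : 0 < τ) (hφ : ContinuousOn φ (Icc (-τ) 0)) :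
    Tendsto (rlPrimitive α τ c h g φ β κ) (𝓝[>] 0) (𝓝 β) := by
  have h1 := (continuous_rlPrimitive (c := c) (h := h) (g := g) (β := β) (κ := κ) hα hτ
    hφ).tendsto 0
  rw [rlPrimitive_zero hα hτ hφ] at h1
  exact h1.mono_left nhdsWithin_le_nhds

theorem tendsto_integral_rlPrimitive (hα : 0 < α) (hτ : 0 < τ)
    (hφ : ContinuousOn φ (Icc (-τ) 0)) (a : ℝ) :
    Tendsto (fun t => a + ∫ s in (0 : ℝ)..t, rlPrimitive α τ c h g φ β κ s) (𝓝[>] 0) (𝓝 a) := by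
  have h1 := (hasDerivAt_integral_rlPrimitive (c := c) (h := h) (g := g) (β := β) (κ := κ) hα hτ hφ
    a 0).continuousAt.tendsto
  rw [intervalIntegral.integral_same, add_zero] at h1
  exact h1.mono_left nhdsWithin_le_nhds

theorem tendsto_rlDeriv_sub_one (hα : 0 < α) (hα2 : α ≤ 2) (hτ : 0 < τ)
    (hφ : ContinuousOn φ (Icc (-τ) 0)) :
    Tendsto (rlDeriv (α - 1) (deltaRL α τ c h g φ β κ)) (𝓝[>] 0) (𝓝 β) := by
  refine (tendsto_rlPrimitive (c := c) (h := h) (g := g) (κ := κ) hα hτ hφ).congr' ?_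
  filter_upwards [self_mem_nhdsWithin] with t ht
  unfold rlDeriv
  rcases le_or_gt α 1 with h1 | h1
  · rw [Nat.ceil_eq_zero.2 (sub_nonpos.2 h1), iteratedDeriv_zero,
      show (((0 : ℕ) : ℝ) - (α - 1)) = 1 - α by push_cast; ring]
    exact (fracInt_deltaRL_of_le_one hα h1 hτ hφ ht).2.symm
  · rw [ceil_eq_one_of_le_one (sub_pos.2 h1) (by linarith), iteratedDeriv_one,
      show (((1 : ℕ) : ℝ) - (α - 1)) = 2 - α by push_cast; ring]
    exact (deriv_fracInt_deltaRL h1 hα2 hτ hφ ht).symm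

theorem tendsto_rlDeriv_sub_two (hα : 0 < α) (hα2 : α ≤ 2) (hτ : 0 < τ)
    (hφ : ContinuousOn φ (Icc (-τ) 0)) :
    Tendsto (rlDeriv (α - 2) (deltaRL α τ c h g φ β κ)) (𝓝[>] 0)
      (𝓝 (velocityDatum α κ)) := by
  refine (tendsto_integral_rlPrimitive (c := c) (h := h) (g := g) (β := β) (κ := κ) hα hτ hφ
    (velocityDatum α κ)).congr' ?_
  filter_upwards [self_mem_nhdsWithin] with t ht
  unfold rlDeriv
  rw [Nat.ceil_eq_zero.2 (sub_nonpos.2 hα2), iteratedDeriv_zero,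
    show (((0 : ℕ) : ℝ) - (α - 2)) = 2 - α by push_cast; ring]
  rcases le_or_gt α 1 with h1 | h1
  · rw [(fracInt_deltaRL hα hτ hφ (Or.inl ⟨by linarith, by linarith⟩) ht).2,
      ← lconv_two_rlRhs hα hτ hφ ht, velocityDatum, if_neg h1.not_gt, add_sub_cancel]
    ring
  · rw [(fracInt_deltaRL_of_one_lt h1 hα2 hτ hφ ht).2, velocityDatum, if_pos h1]

end rl

/-! ### Linearity in the data -/

section linear

variable {α τ c h : ℝ} {φ₁ φ₂ : ℝ → ℝ}

theorem lconv_history_linear (hα : 0 < α) (hτ : 0 < τ) (h₁ : ContinuousOn φ₁ (Icc (-τ) 0))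
    (h₂ : ContinuousOn φ₂ (Icc (-τ) 0)) (p q t : ℝ) :
    (history τ (fun s => p * φ₁ s + q * φ₂ s) ⊛ delayKernel α τ c h α) t =
      p * (history τ φ₁ ⊛ delayKernel α τ c h α) t
        + q * (history τ φ₂ ⊛ delayKernel α τ c h α) t := by
  have hex {φ : ℝ → ℝ} (hφ : ContinuousOn φ (Icc (-τ) 0)) :
      LConvAt (history τ φ) (delayKernel α τ c h α) t := by
    obtain ⟨C, hC⟩ := history_bounded hφ
    exact ((causalLI_delayKernel hα hτ hα).lConvAt_of_bounded (causalLI_history hτ hφ)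
      (fun _ => ⟨C, fun t _ => hC t⟩) t).symm
  have e : history τ (fun s => p * φ₁ s + q * φ₂ s) =
      fun s => p * history τ φ₁ s + q * history τ φ₂ s := by
    funext s
    simp only [history]
    split_ifs <;> ring
  rw [e, lconv_add_left ((hex h₁).const_mul_left p) ((hex h₂).const_mul_left q),
    lconv_const_mul_left, lconv_const_mul_left]

theorem deltaCaputo_linear (hα : 0 < α) (hτ : 0 < τ) (h₁ : ContinuousOn φ₁ (Icc (-τ) 0))
    (h₂ : ContinuousOn φ₂ (Icc (-τ) 0)) (p q g₁ g₂ κ₁ κ₂ : ℝ) :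
    deltaCaputo α τ c h (p * g₁ + q * g₂) (fun s => p * φ₁ s + q * φ₂ s) (p * κ₁ + q * κ₂) =
      fun t => p * deltaCaputo α τ c h g₁ φ₁ κ₁ t + q * deltaCaputo α τ c h g₂ φ₂ κ₂ t := by
  funext t
  simp only [deltaCaputo]
  by_cases ht : t ≤ 0
  · simp only [if_pos ht]
  · simp only [if_neg ht]
    have ht' : 0 < t := not_le.1 ht
    rw [conv_history hα hτ φ₁ ht', conv_history hα hτ φ₂ ht',
      conv_history hα hτ (fun s => p * φ₁ s + q * φ₂ s) ht', lconv_history_linear hα hτ h₁ h₂]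
    split_ifs <;> ring

theorem deltaRL_linear (hα : 0 < α) (hτ : 0 < τ) (h₁ : ContinuousOn φ₁ (Icc (-τ) 0))
    (h₂ : ContinuousOn φ₂ (Icc (-τ) 0)) (p q g₁ g₂ β₁ β₂ κ₁ κ₂ : ℝ) :
    deltaRL α τ c h (p * g₁ + q * g₂) (fun s => p * φ₁ s + q * φ₂ s) (p * β₁ + q * β₂)
        (p * κ₁ + q * κ₂) =
      fun t => p * deltaRL α τ c h g₁ φ₁ β₁ κ₁ t + q * deltaRL α τ c h g₂ φ₂ β₂ κ₂ t := by
  funext t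
  simp only [deltaRL]
  by_cases ht : t ≤ 0
  · simp only [if_pos ht]
  · simp only [if_neg ht]
    have ht' : 0 < t := not_le.1 ht
    rw [conv_history hα hτ φ₁ ht', conv_history hα hτ φ₂ ht',
      conv_history hα hτ (fun s => p * φ₁ s + q * φ₂ s) ht', lconv_history_linear hα hτ h₁ h₂]
    split_ifs <;> ring

theorem hasCaputoDeriv_linear (hα : 0 < α) (hα2 : α ≤ 2) (hτ : 0 < τ)
    (h₁ : AbsolutelyContinuousOnInterval φ₁ (-τ) 0)
    (h₂ : AbsolutelyContinuousOnInterval φ₂ (-τ) 0) (p q g₁ g₂ κ₁ κ₂ : ℝ) {t : ℝ} (ht : 0 < t) :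
    HasCaputoDeriv α
      (fun s => p * deltaCaputo α τ c h g₁ φ₁ κ₁ s + q * deltaCaputo α τ c h g₂ φ₂ κ₂ s) t
      (p * (g₁ + c * deltaCaputo α τ c h g₁ φ₁ κ₁ t
          + h * deltaCaputo α τ c h g₁ φ₁ κ₁ (t - τ))
        + q * (g₂ + c * deltaCaputo α τ c h g₂ φ₂ κ₂ t
          + h * deltaCaputo α τ c h g₂ φ₂ κ₂ (t - τ))) := by
  have e := deltaCaputo_linear (c := c) (h := h) hα hτ (continuousOn_of_absolutelyContinuous hτ h₁)
    (continuousOn_of_absolutelyContinuous hτ h₂) p q g₁ g₂ κ₁ κ₂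
  have hd := hasCaputoDeriv_deltaCaputo (c := c) (h := h) (g := p * g₁ + q * g₂)
    (κ := p * κ₁ + q * κ₂) hα hα2 hτ ((h₁.const_mul p).add (h₂.const_mul q)) ht
  change HasCaputoDeriv α (deltaCaputo α τ c h _ (fun s => p * φ₁ s + q * φ₂ s) _) t
    (_ + c * deltaCaputo α τ c h _ (fun s => p * φ₁ s + q * φ₂ s) _ t
      + h * deltaCaputo α τ c h _ (fun s => p * φ₁ s + q * φ₂ s) _ (t - τ)) at hd
  rw [e] at hd
  convert hd using 1
  ring

theorem hasDerivWithinAt_linear (hα : 1 < α) (hτ : 0 < τ)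
    (h₁ : AbsolutelyContinuousOnInterval φ₁ (-τ) 0)
    (h₂ : AbsolutelyContinuousOnInterval φ₂ (-τ) 0) (p q g₁ g₂ κ₁ κ₂ : ℝ) :
    HasDerivWithinAt
      (fun s => p * deltaCaputo α τ c h g₁ φ₁ κ₁ s + q * deltaCaputo α τ c h g₂ φ₂ κ₂ s)
      (p * κ₁ + q * κ₂) (Ici 0) 0 :=
  ((hasDerivWithinAt_deltaCaputo hα hτ h₁).const_mul p).add
    ((hasDerivWithinAt_deltaCaputo hα hτ h₂).const_mul q)

theorem rlRegular_linear (hα : 0 < α) (hα2 : α ≤ 2) (hτ : 0 < τ)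
    (h₁ : ContinuousOn φ₁ (Icc (-τ) 0)) (h₂ : ContinuousOn φ₂ (Icc (-τ) 0))
    (p q g₁ g₂ β₁ β₂ κ₁ κ₂ : ℝ) :
    RLRegular α fun s =>
      p * deltaRL α τ c h g₁ φ₁ β₁ κ₁ s + q * deltaRL α τ c h g₂ φ₂ β₂ κ₂ s := by
  rw [← deltaRL_linear hα hτ h₁ h₂]
  exact rlRegular_deltaRL hα hα2 hτ ((continuousOn_const.mul h₁).add (continuousOn_const.mul h₂))

theorem hasRLDeriv_linear (hα : 0 < α) (hα2 : α ≤ 2) (hτ : 0 < τ)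
    (h₁ : ContinuousOn φ₁ (Icc (-τ) 0)) (h₂ : ContinuousOn φ₂ (Icc (-τ) 0))
    (p q g₁ g₂ β₁ β₂ κ₁ κ₂ : ℝ) {t : ℝ} (ht : 0 < t) (ht' : ∀ m : ℕ, t ≠ m * τ) :
    HasRLDeriv α
      (fun s => p * deltaRL α τ c h g₁ φ₁ β₁ κ₁ s + q * deltaRL α τ c h g₂ φ₂ β₂ κ₂ s) t
      (p * (g₁ + c * deltaRL α τ c h g₁ φ₁ β₁ κ₁ t + h * deltaRL α τ c h g₁ φ₁ β₁ κ₁ (t - τ))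
        + q * (g₂ + c * deltaRL α τ c h g₂ φ₂ β₂ κ₂ t
          + h * deltaRL α τ c h g₂ φ₂ β₂ κ₂ (t - τ))) := by
  have e := deltaRL_linear (c := c) (h := h) hα hτ h₁ h₂ p q g₁ g₂ β₁ β₂ κ₁ κ₂
  have hd := hasRLDeriv_deltaRL (c := c) (h := h) (g := p * g₁ + q * g₂)
    (β := p * β₁ + q * β₂) (κ := p * κ₁ + q * κ₂) (φ := fun s => p * φ₁ s + q * φ₂ s) hα hα2 hτ
    ((continuousOn_const.mul h₁).add (continuousOn_const.mul h₂)) ht ht'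
  rw [e] at hd
  convert hd using 1
  ring

theorem tendsto_rlDeriv_sub_one_linear (hα : 0 < α) (hα2 : α ≤ 2) (hτ : 0 < τ)
    (h₁ : ContinuousOn φ₁ (Icc (-τ) 0)) (h₂ : ContinuousOn φ₂ (Icc (-τ) 0))
    (p q g₁ g₂ β₁ β₂ κ₁ κ₂ : ℝ) :
    Tendsto (rlDeriv (α - 1) fun s =>
      p * deltaRL α τ c h g₁ φ₁ β₁ κ₁ s + q * deltaRL α τ c h g₂ φ₂ β₂ κ₂ s) (𝓝[>] 0)
      (𝓝 (p * β₁ + q * β₂)) := by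
  rw [← deltaRL_linear hα hτ h₁ h₂]
  exact tendsto_rlDeriv_sub_one hα hα2 hτ
    ((continuousOn_const.mul h₁).add (continuousOn_const.mul h₂))

theorem tendsto_rlDeriv_sub_two_linear (hα : 0 < α) (hα2 : α ≤ 2) (hτ : 0 < τ)
    (h₁ : ContinuousOn φ₁ (Icc (-τ) 0)) (h₂ : ContinuousOn φ₂ (Icc (-τ) 0))
    (p q g₁ g₂ β₁ β₂ κ₁ κ₂ : ℝ) :
    Tendsto (rlDeriv (α - 2) fun s =>
      p * deltaRL α τ c h g₁ φ₁ β₁ κ₁ s + q * deltaRL α τ c h g₂ φ₂ β₂ κ₂ s) (𝓝[>] 0)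
      (𝓝 (if 1 < α then p * κ₁ + q * κ₂ else 0)) := by
  rw [← deltaRL_linear hα hτ h₁ h₂]
  exact tendsto_rlDeriv_sub_two hα hα2 hτ
    ((continuousOn_const.mul h₁).add (continuousOn_const.mul h₂))

end linear

/-! ### The operator on the invariant space -/

theorem hasDerivAt_linPart (p q x : ℝ) : HasDerivAt (linPart p q) q x := by
  have h := ((hasDerivAt_id x).const_mul q).const_add p
  rw [mul_one] at h
  exact h

theorem hasDerivAt_trigPart (μ p q x : ℝ) :
    HasDerivAt (trigPart μ p q) (trigPart μ (-(√μ * q)) (√μ * p) x) x := by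
  have h : HasDerivAt (fun y => √μ * y) √μ x := by simpa using (hasDerivAt_id x).const_mul √μ
  convert! (h.sin.const_mul p).add (h.cos.const_mul q) using 1
  rw [trigPart]
  ring

/-- The operator on the invariant space, for arbitrary coefficients. -/
theorem drOp_linPart_trigPart (c : DRCoeff) (hμ : 0 < c.μ) (p₁ q₁ p₂ q₂ r₁ s₁ r₂ s₂ : ℝ) :
    drOp c (linPart p₁ q₁, trigPart c.μ p₂ q₂) (linPart r₁ s₁, trigPart c.μ r₂ s₂) =
      (linPart (c.γ₁₀ + c.γ₁₁ * p₁ + c.γ'₁₁ * r₁ + c.a₁₁ * q₁ ^ 2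
          + c.b₁₂ * c.μ * (p₂ ^ 2 + q₂ ^ 2)) (c.γ₁₁ * q₁ + c.γ'₁₁ * s₁),
        trigPart c.μ
          ((c.γ₂₂ - c.μ * c.b₂₀) * p₂ + c.γ'₂₂ * r₂ - √c.μ * (c.a₂₂ + c.b₂₁) * q₁ * q₂)
          ((c.γ₂₂ - c.μ * c.b₂₀) * q₂ + c.γ'₂₂ * s₂ + √c.μ * (c.a₂₂ + c.b₂₁) * q₁ * p₂)) := by
  have hsq : √c.μ ^ 2 = c.μ := Real.sq_sqrt hμ.le
  have hd₁ : deriv (linPart p₁ q₁) = fun _ => q₁ :=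
    funext fun x => (hasDerivAt_linPart p₁ q₁ x).deriv
  have hd₂ : deriv (trigPart c.μ p₂ q₂) = trigPart c.μ (-(√c.μ * q₂)) (√c.μ * p₂) :=
    funext fun x => (hasDerivAt_trigPart c.μ p₂ q₂ x).deriv
  refine Prod.ext (funext fun x => ?_) (funext fun x => ?_)
  · simp only [drOp, hd₁, hd₂]
    have hu := hasDerivAt_linPart p₁ q₁ x
    have hv := hasDerivAt_trigPart c.μ p₂ q₂ x
    have hw := hasDerivAt_trigPart c.μ (-(√c.μ * q₂)) (√c.μ * p₂) x
    have h := ((((hv.const_mul c.a₁₂).add (hu.const_mul c.a₁₁)).add_const c.a₁₀).mul_const q₁).add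
      ((((hv.const_mul c.b₁₂).sub (hu.const_mul c.a₁₂)).add_const (c.γ₁₂ / c.μ)).mul hw)
    refine (congrArg (fun d => d - c.μ * c.a₁₂ * linPart p₁ q₁ x * trigPart c.μ p₂ q₂ x
      + 2 * c.μ * c.b₁₂ * trigPart c.μ p₂ q₂ x ^ 2 + c.γ₁₂ * trigPart c.μ p₂ q₂ x
      + c.γ₁₁ * linPart p₁ q₁ x + c.γ₁₀ + c.γ'₁₁ * linPart r₁ s₁ x) h.deriv).trans ?_
    have hcs := Real.sin_sq_add_cos_sq (√c.μ * x)
    have hγ : c.γ₁₂ / c.μ * c.μ = c.γ₁₂ := div_mul_cancel₀ _ hμ.ne'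
    simp only [linPart, trigPart, Pi.sub_apply]
    generalize Real.sin (√c.μ * x) = S at *
    generalize Real.cos (√c.μ * x) = C at *
    generalize c.γ₁₂ / c.μ = e at *
    generalize √c.μ = m at *
    rw [← hγ, ← hsq]
    linear_combination (c.b₁₂ * m ^ 2 * (p₂ ^ 2 + q₂ ^ 2)) * hcs
  · simp only [drOp, hd₁, hd₂]
    have hu := hasDerivAt_linPart p₁ q₁ x
    have hv := hasDerivAt_trigPart c.μ p₂ q₂ x
    have hw := hasDerivAt_trigPart c.μ (-(√c.μ * q₂)) (√c.μ * p₂) x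
    have h := (((hv.const_mul c.a₂₂).add_const c.a₂₀).mul_const q₁).add
      (((hu.const_mul c.b₂₁).add_const c.b₂₀).mul hw)
    refine (congrArg (fun d => d + c.μ * c.b₂₁ * linPart p₁ q₁ x * trigPart c.μ p₂ q₂ x
      + c.γ₂₂ * trigPart c.μ p₂ q₂ x + c.γ'₂₂ * trigPart c.μ r₂ s₂ x) h.deriv).trans ?_
    simp only [linPart, trigPart]
    generalize Real.sin (√c.μ * x) = S at *
    generalize Real.cos (√c.μ * x) = C at *
    generalize √c.μ = m at *
    rw [← hsq]
    ring

theorem drOp_reduction (c : DRCoeff) (hμ : 0 < c.μ) (h₁ : c.a₁₁ = 0) (h₂ : c.b₁₂ = 0)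
    (h₃ : c.a₂₂ = -c.b₂₁) (p₁ q₁ p₂ q₂ r₁ s₁ r₂ s₂ : ℝ) :
    drOp c (linPart p₁ q₁, trigPart c.μ p₂ q₂) (linPart r₁ s₁, trigPart c.μ r₂ s₂) =
      (linPart (c.γ₁₀ + c.γ₁₁ * p₁ + c.γ'₁₁ * r₁) (c.γ₁₁ * q₁ + c.γ'₁₁ * s₁),
        trigPart c.μ ((c.γ₂₂ - c.μ * c.b₂₀) * p₂ + c.γ'₂₂ * r₂)
          ((c.γ₂₂ - c.μ * c.b₂₀) * q₂ + c.γ'₂₂ * s₂)) := by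
  rw [drOp_linPart_trigPart c hμ, h₁, h₂, h₃]
  congr 2 <;> ring

theorem mem_polyTrigSpace_iff {μ : ℝ} {U : (ℝ → ℝ) × (ℝ → ℝ)} :
    U ∈ polyTrigSpace μ ↔ ∃ p₁ q₁ p₂ q₂, U = (linPart p₁ q₁, trigPart μ p₂ q₂) := by
  rw [polyTrigSpace, Submodule.mem_prod, Submodule.mem_span_pair, Submodule.mem_span_pair]
  have e₁ (p q : ℝ) : (p • (fun _ => 1 : ℝ → ℝ) + q • fun x : ℝ => x) = linPart p q := by
    funext x
    simp [linPart]
  have e₂ (p q : ℝ) : (p • (fun x => Real.sin (√μ * x) : ℝ → ℝ) + q • fun x : ℝ =>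
      Real.cos (√μ * x)) = trigPart μ p q := rfl
  simp only [e₁, e₂]
  constructor
  · rintro ⟨⟨p₁, q₁, h₁⟩, p₂, q₂, h₂⟩
    exact ⟨p₁, q₁, p₂, q₂, Prod.ext h₁.symm h₂.symm⟩
  · rintro ⟨p₁, q₁, p₂, q₂, rfl⟩
    exact ⟨⟨p₁, q₁, rfl⟩, p₂, q₂, rfl⟩

theorem drOp_mem_polyTrigSpace (c : DRCoeff) (hμ : 0 < c.μ) {U V : (ℝ → ℝ) × (ℝ → ℝ)}
    (hU : U ∈ polyTrigSpace c.μ) (hV : V ∈ polyTrigSpace c.μ) :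
    drOp c U V ∈ polyTrigSpace c.μ := by
  obtain ⟨p₁, q₁, p₂, q₂, rfl⟩ := mem_polyTrigSpace_iff.1 hU
  obtain ⟨r₁, s₁, r₂, s₂, rfl⟩ := mem_polyTrigSpace_iff.1 hV
  exact mem_polyTrigSpace_iff.2 ⟨_, _, _, _, drOp_linPart_trigPart c hμ _ _ _ _ _ _ _ _⟩

theorem mainTheorem6 (c : DRCoeff) (hμ : 0 < c.μ) (α₁ α₂ τ₁ τ₂ : ℝ)
    (hα₁ : 0 < α₁) (hα₁' : α₁ ≤ 2) (hα₂ : 0 < α₂) (hα₂' : α₂ ≤ 2)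
    (hτ₁ : 0 < τ₁) (hτ₂ : 0 < τ₂) :
    -- the space is invariant, for all coefficients
    (∀ U ∈ polyTrigSpace c.μ, ∀ V ∈ polyTrigSpace c.μ, drOp c U V ∈ polyTrigSpace c.μ) ∧
    (c.a₁₁ = 0 → c.b₁₂ = 0 → c.a₂₂ = -c.b₂₁ →
      -- reduction to delay equations for the coefficients
      (∀ p₁ q₁ p₂ q₂ r₁ s₁ r₂ s₂ : ℝ,
        drOp c (linPart p₁ q₁, trigPart c.μ p₂ q₂) (linPart r₁ s₁, trigPart c.μ r₂ s₂) =
          (linPart (c.γ₁₀ + c.γ₁₁ * p₁ + c.γ'₁₁ * r₁) (c.γ₁₁ * q₁ + c.γ'₁₁ * s₁),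
           trigPart c.μ ((c.γ₂₂ - c.μ * c.b₂₀) * p₂ + c.γ'₂₂ * r₂)
            ((c.γ₂₂ - c.μ * c.b₂₀) * q₂ + c.γ'₂₂ * s₂))) ∧
      -- the Caputo case
      (∀ (φ₁₁ φ₁₂ φ₂₁ φ₂₂ : ℝ → ℝ) (κ₁₁ κ₁₂ κ₂₁ κ₂₂ : ℝ),
        AbsolutelyContinuousOnInterval φ₁₁ (-τ₁) 0 →
        AbsolutelyContinuousOnInterval φ₁₂ (-τ₁) 0 →
        AbsolutelyContinuousOnInterval φ₂₁ (-τ₂) 0 →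
        AbsolutelyContinuousOnInterval φ₂₂ (-τ₂) 0 →
        ∀ (δ₁₁ δ₁₂ δ₂₁ δ₂₂ : ℝ → ℝ) (u₁ u₂ : ℝ → ℝ → ℝ),
        δ₁₁ = deltaCaputo α₁ τ₁ c.γ₁₁ c.γ'₁₁ c.γ₁₀ φ₁₁ κ₁₁ →
        δ₁₂ = deltaCaputo α₁ τ₁ c.γ₁₁ c.γ'₁₁ 0 φ₁₂ κ₁₂ →
        δ₂₁ = deltaCaputo α₂ τ₂ (c.γ₂₂ - c.μ * c.b₂₀) c.γ'₂₂ 0 φ₂₁ κ₂₁ →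
        δ₂₂ = deltaCaputo α₂ τ₂ (c.γ₂₂ - c.μ * c.b₂₀) c.γ'₂₂ 0 φ₂₂ κ₂₂ →
        u₁ = (fun x t => linPart (δ₁₁ t) (δ₁₂ t) x) →
        u₂ = (fun x t => trigPart c.μ (δ₂₁ t) (δ₂₂ t) x) →
        -- the coefficients solve the reduced system
        (∀ t, 0 < t →
          HasCaputoDeriv α₁ δ₁₁ t (c.γ₁₀ + c.γ₁₁ * δ₁₁ t + c.γ'₁₁ * δ₁₁ (t - τ₁)) ∧
          HasCaputoDeriv α₁ δ₁₂ t (c.γ₁₁ * δ₁₂ t + c.γ'₁₁ * δ₁₂ (t - τ₁)) ∧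
          HasCaputoDeriv α₂ δ₂₁ t
            ((c.γ₂₂ - c.μ * c.b₂₀) * δ₂₁ t + c.γ'₂₂ * δ₂₁ (t - τ₂)) ∧
          HasCaputoDeriv α₂ δ₂₂ t
            ((c.γ₂₂ - c.μ * c.b₂₀) * δ₂₂ t + c.γ'₂₂ * δ₂₂ (t - τ₂))) ∧
        -- the system with its history
        IsCaputoSolution c α₁ α₂ τ₁ τ₂
          (fun x t => linPart (φ₁₁ t) (φ₁₂ t) x) (fun x t => trigPart c.μ (φ₂₁ t) (φ₂₂ t) x)
          u₁ u₂ ∧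
        -- initial conditions
        (∀ x, u₁ x 0 = φ₁₁ 0 + φ₁₂ 0 * x) ∧
        (∀ x, u₂ x 0 = φ₂₁ 0 * Real.sin (√c.μ * x) + φ₂₂ 0 * Real.cos (√c.μ * x)) ∧
        (1 < α₁ → ∀ x, HasDerivWithinAt (fun t => u₁ x t) (κ₁₁ + κ₁₂ * x) (Ici 0) 0) ∧
        (1 < α₂ → ∀ x, HasDerivWithinAt (fun t => u₂ x t)
          (κ₂₁ * Real.sin (√c.μ * x) + κ₂₂ * Real.cos (√c.μ * x)) (Ici 0) 0) ∧
        -- boundary conditions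
        (∀ l t : ℝ, u₁ 0 t = δ₁₁ t ∧ u₁ l t = δ₁₁ t + l * δ₁₂ t ∧ u₂ 0 t = δ₂₂ t ∧
          u₂ l t = Real.sin (l * √c.μ) * δ₂₁ t + Real.cos (l * √c.μ) * δ₂₂ t)) ∧
      -- the Riemann-Liouville case
      (∀ (φ₁₁ φ₁₂ φ₂₁ φ₂₂ : ℝ → ℝ) (β₁₁ β₁₂ β₂₁ β₂₂ κ₁₁ κ₁₂ κ₂₁ κ₂₂ : ℝ),
        ContinuousOn φ₁₁ (Icc (-τ₁) 0) → ContinuousOn φ₁₂ (Icc (-τ₁) 0) →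
        ContinuousOn φ₂₁ (Icc (-τ₂) 0) → ContinuousOn φ₂₂ (Icc (-τ₂) 0) →
        ∀ (δ₁₁ δ₁₂ δ₂₁ δ₂₂ : ℝ → ℝ) (u₁ u₂ : ℝ → ℝ → ℝ),
        δ₁₁ = deltaRL α₁ τ₁ c.γ₁₁ c.γ'₁₁ c.γ₁₀ φ₁₁ β₁₁ κ₁₁ →
        δ₁₂ = deltaRL α₁ τ₁ c.γ₁₁ c.γ'₁₁ 0 φ₁₂ β₁₂ κ₁₂ →
        δ₂₁ = deltaRL α₂ τ₂ (c.γ₂₂ - c.μ * c.b₂₀) c.γ'₂₂ 0 φ₂₁ β₂₁ κ₂₁ →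
        δ₂₂ = deltaRL α₂ τ₂ (c.γ₂₂ - c.μ * c.b₂₀) c.γ'₂₂ 0 φ₂₂ β₂₂ κ₂₂ →
        u₁ = (fun x t => linPart (δ₁₁ t) (δ₁₂ t) x) →
        u₂ = (fun x t => trigPart c.μ (δ₂₁ t) (δ₂₂ t) x) →
        -- the coefficients solve the reduced system
        (∀ t, 0 < t → (∀ m : ℕ, t ≠ m * τ₁) →
          HasRLDeriv α₁ δ₁₁ t (c.γ₁₀ + c.γ₁₁ * δ₁₁ t + c.γ'₁₁ * δ₁₁ (t - τ₁)) ∧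
          HasRLDeriv α₁ δ₁₂ t (c.γ₁₁ * δ₁₂ t + c.γ'₁₁ * δ₁₂ (t - τ₁))) ∧
        (∀ t, 0 < t → (∀ m : ℕ, t ≠ m * τ₂) →
          HasRLDeriv α₂ δ₂₁ t
            ((c.γ₂₂ - c.μ * c.b₂₀) * δ₂₁ t + c.γ'₂₂ * δ₂₁ (t - τ₂)) ∧
          HasRLDeriv α₂ δ₂₂ t
            ((c.γ₂₂ - c.μ * c.b₂₀) * δ₂₂ t + c.γ'₂₂ * δ₂₂ (t - τ₂))) ∧
        -- the system with its history
        IsRLSolution c α₁ α₂ τ₁ τ₂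
          (fun x t => linPart (φ₁₁ t) (φ₁₂ t) x) (fun x t => trigPart c.μ (φ₂₁ t) (φ₂₂ t) x)
          u₁ u₂ ∧
        -- initial conditions
        (∀ x, Tendsto (rlDeriv (α₁ - 1) (fun t => u₁ x t)) (𝓝[>] 0) (𝓝 (β₁₁ + β₁₂ * x))) ∧
        (∀ x, Tendsto (rlDeriv (α₂ - 1) (fun t => u₂ x t)) (𝓝[>] 0)
          (𝓝 (β₂₁ * Real.sin (√c.μ * x) + β₂₂ * Real.cos (√c.μ * x)))) ∧
        (∀ x, Tendsto (rlDeriv (α₁ - 2) (fun t => u₁ x t)) (𝓝[>] 0)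
          (𝓝 (if 1 < α₁ then κ₁₁ + κ₁₂ * x else 0))) ∧
        (∀ x, Tendsto (rlDeriv (α₂ - 2) (fun t => u₂ x t)) (𝓝[>] 0)
          (𝓝 (if 1 < α₂ then κ₂₁ * Real.sin (√c.μ * x) + κ₂₂ * Real.cos (√c.μ * x) else 0))) ∧
        -- boundary conditions
        (∀ l t : ℝ, u₁ 0 t = δ₁₁ t ∧ u₁ l t = δ₁₁ t + l * δ₁₂ t ∧ u₂ 0 t = δ₂₂ t ∧
          u₂ l t = Real.sin (l * √c.μ) * δ₂₁ t + Real.cos (l * √c.μ) * δ₂₂ t))) := by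
  -- for fixed `x`, both components are linear combinations of coefficient functions in time
  have hlin (a b x : ℝ) : linPart a b x = 1 * a + x * b := by rw [linPart]; ring
  have htrig (a b x : ℝ) : trigPart c.μ a b x =
      Real.sin (√c.μ * x) * a + Real.cos (√c.μ * x) * b := by rw [trigPart]; ring
  refine ⟨fun U hU V hV => drOp_mem_polyTrigSpace c hμ hU hV, fun ha₁₁ hb₁₂ ha₂₂ => ?_⟩
  have hred := drOp_reduction c hμ ha₁₁ hb₁₂ ha₂₂
  have hbd (δ₁₁ δ₁₂ δ₂₁ δ₂₂ : ℝ → ℝ) (l t : ℝ) :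
      linPart (δ₁₁ t) (δ₁₂ t) 0 = δ₁₁ t ∧ linPart (δ₁₁ t) (δ₁₂ t) l = δ₁₁ t + l * δ₁₂ t ∧
      trigPart c.μ (δ₂₁ t) (δ₂₂ t) 0 = δ₂₂ t ∧ trigPart c.μ (δ₂₁ t) (δ₂₂ t) l =
        Real.sin (l * √c.μ) * δ₂₁ t + Real.cos (l * √c.μ) * δ₂₂ t := by
    refine ⟨by simp [linPart], by rw [linPart]; ring, by simp [trigPart], ?_⟩
    rw [htrig, mul_comm l]
  refine ⟨hred, ?_, ?_⟩
  · intro φ₁₁ φ₁₂ φ₂₁ φ₂₂ κ₁₁ κ₁₂ κ₂₁ κ₂₂ h₁₁ h₁₂ h₂₁ h₂₂ δ₁₁ δ₁₂ δ₂₁ δ₂₂ u₁ u₂ hδ₁₁ hδ₁₂ hδ₂₁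
      hδ₂₂ hu₁ hu₂
    have hle {α τ c h g κ : ℝ} {φ : ℝ → ℝ} {t : ℝ} (ht : t ≤ 0) :
        deltaCaputo α τ c h g φ κ t = φ t := if_pos ht
    subst hu₁ hu₂
    refine ⟨fun t ht => ⟨?_, ?_, ?_, ?_⟩, ⟨?_, ?_, ?_, ?_⟩, ?_, ?_, ?_, ?_, ?_⟩
    · rw [hδ₁₁]
      exact hasCaputoDeriv_deltaCaputo hα₁ hα₁' hτ₁ h₁₁ ht
    · rw [hδ₁₂]
      simpa using hasCaputoDeriv_deltaCaputo (g := 0) hα₁ hα₁' hτ₁ h₁₂ ht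
    · rw [hδ₂₁]
      simpa using hasCaputoDeriv_deltaCaputo (g := 0) hα₂ hα₂' hτ₂ h₂₁ ht
    · rw [hδ₂₂]
      simpa using hasCaputoDeriv_deltaCaputo (g := 0) hα₂ hα₂' hτ₂ h₂₂ ht
    · intro x t ht
      simp only [hδ₁₁, hδ₁₂, hle ht.2]
    · intro x t ht
      simp only [hδ₂₁, hδ₂₂, hle ht.2]
    · intro x t ht
      refine (congrArg (fun W : (ℝ → ℝ) × (ℝ → ℝ) => HasCaputoDeriv α₁ _ t (W.1 x))
        (hred _ _ _ _ _ _ _ _)).mpr ?_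
      simp only [hlin, hδ₁₁, hδ₁₂]
      convert hasCaputoDeriv_linear hα₁ hα₁' hτ₁ h₁₁ h₁₂ 1 x _ 0 κ₁₁ κ₁₂ ht using 1
      ring
    · intro x t ht
      refine (congrArg (fun W : (ℝ → ℝ) × (ℝ → ℝ) => HasCaputoDeriv α₂ _ t (W.2 x))
        (hred _ _ _ _ _ _ _ _)).mpr ?_
      simp only [htrig, hδ₂₁, hδ₂₂]
      convert hasCaputoDeriv_linear hα₂ hα₂' hτ₂ h₂₁ h₂₂ (Real.sin (√c.μ * x))
        (Real.cos (√c.μ * x)) 0 0 κ₂₁ κ₂₂ ht using 1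
      ring
    · intro x
      simp only [hδ₁₁, hδ₁₂, hle le_rfl, linPart]
    · intro x
      simp only [hδ₂₁, hδ₂₂, hle le_rfl, trigPart]
    · intro hα x
      simp only [hlin, hδ₁₁, hδ₁₂]
      convert hasDerivWithinAt_linear hα hτ₁ h₁₁ h₁₂ 1 x _ 0 κ₁₁ κ₁₂ using 1
      ring
    · intro hα x
      simp only [htrig, hδ₂₁, hδ₂₂]
      convert hasDerivWithinAt_linear hα hτ₂ h₂₁ h₂₂ (Real.sin (√c.μ * x))
        (Real.cos (√c.μ * x)) 0 0 κ₂₁ κ₂₂ using 1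
      ring
    · exact hbd δ₁₁ δ₁₂ δ₂₁ δ₂₂
  · intro φ₁₁ φ₁₂ φ₂₁ φ₂₂ β₁₁ β₁₂ β₂₁ β₂₂ κ₁₁ κ₁₂ κ₂₁ κ₂₂ h₁₁ h₁₂ h₂₁ h₂₂ δ₁₁ δ₁₂ δ₂₁ δ₂₂ u₁ u₂
      hδ₁₁ hδ₁₂ hδ₂₁ hδ₂₂ hu₁ hu₂
    have hle {α τ c h g β κ : ℝ} {φ : ℝ → ℝ} {t : ℝ} (ht : t ≤ 0) :
        deltaRL α τ c h g φ β κ t = φ t := if_pos ht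
    subst hu₁ hu₂
    refine ⟨fun t ht ht' => ⟨?_, ?_⟩, fun t ht ht' => ⟨?_, ?_⟩, ⟨?_, ?_, ?_, ?_, ?_, ?_⟩, ?_, ?_,
      ?_, ?_, ?_⟩
    · rw [hδ₁₁]
      exact hasRLDeriv_deltaRL hα₁ hα₁' hτ₁ h₁₁ ht ht'
    · rw [hδ₁₂]
      simpa using hasRLDeriv_deltaRL (g := 0) hα₁ hα₁' hτ₁ h₁₂ ht ht'
    · rw [hδ₂₁]
      simpa using hasRLDeriv_deltaRL (g := 0) hα₂ hα₂' hτ₂ h₂₁ ht ht'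
    · rw [hδ₂₂]
      simpa using hasRLDeriv_deltaRL (g := 0) hα₂ hα₂' hτ₂ h₂₂ ht ht'
    · intro x t ht
      simp only [hδ₁₁, hδ₁₂, hle ht.2]
    · intro x t ht
      simp only [hδ₂₁, hδ₂₂, hle ht.2]
    · intro x
      simp only [hlin, hδ₁₁, hδ₁₂]
      exact rlRegular_linear hα₁ hα₁' hτ₁ h₁₁ h₁₂ 1 x _ 0 β₁₁ β₁₂ κ₁₁ κ₁₂
    · intro x
      simp only [htrig, hδ₂₁, hδ₂₂]
      exact rlRegular_linear hα₂ hα₂' hτ₂ h₂₁ h₂₂ _ _ 0 0 β₂₁ β₂₂ κ₂₁ κ₂₂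
    · intro x t ht ht'
      refine (congrArg (fun W : (ℝ → ℝ) × (ℝ → ℝ) => HasRLDeriv α₁ _ t (W.1 x))
        (hred _ _ _ _ _ _ _ _)).mpr ?_
      simp only [hlin, hδ₁₁, hδ₁₂]
      convert hasRLDeriv_linear hα₁ hα₁' hτ₁ h₁₁ h₁₂ 1 x _ 0 β₁₁ β₁₂ κ₁₁ κ₁₂ ht ht' using 1
      ring
    · intro x t ht ht'
      refine (congrArg (fun W : (ℝ → ℝ) × (ℝ → ℝ) => HasRLDeriv α₂ _ t (W.2 x))
        (hred _ _ _ _ _ _ _ _)).mpr ?_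
      simp only [htrig, hδ₂₁, hδ₂₂]
      convert hasRLDeriv_linear hα₂ hα₂' hτ₂ h₂₁ h₂₂ (Real.sin (√c.μ * x))
        (Real.cos (√c.μ * x)) 0 0 β₂₁ β₂₂ κ₂₁ κ₂₂ ht ht' using 1
      ring
    · intro x
      simp only [hlin, hδ₁₁, hδ₁₂]
      convert tendsto_rlDeriv_sub_one_linear hα₁ hα₁' hτ₁ h₁₁ h₁₂ 1 x _ 0 β₁₁ β₁₂ κ₁₁ κ₁₂ using 2
      ring
    · intro x
      simp only [htrig, hδ₂₁, hδ₂₂]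
      convert tendsto_rlDeriv_sub_one_linear hα₂ hα₂' hτ₂ h₂₁ h₂₂ (Real.sin (√c.μ * x))
        (Real.cos (√c.μ * x)) 0 0 β₂₁ β₂₂ κ₂₁ κ₂₂ using 2
      ring
    · intro x
      simp only [hlin, hδ₁₁, hδ₁₂]
      convert tendsto_rlDeriv_sub_two_linear hα₁ hα₁' hτ₁ h₁₁ h₁₂ 1 x _ 0 β₁₁ β₁₂ κ₁₁ κ₁₂ using 3
      ring
    · intro x
      simp only [htrig, hδ₂₁, hδ₂₂]
      convert tendsto_rlDeriv_sub_two_linear hα₂ hα₂' hτ₂ h₂₁ h₂₂ (Real.sin (√c.μ * x))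
        (Real.cos (√c.μ * x)) 0 0 β₂₁ β₂₂ κ₂₁ κ₂₂ using 3
      ring
    · exact hbd δ₁₁ δ₁₂ δ₂₁ δ₂₂
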